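/- Let $\mathbb T=\mathbb R/2\pi\mathbb Z$. For $0<\varepsilon<1$ put $a=\frac{1-\varepsilon}2$, $b=\frac{1+\varepsilon}2$ and $S_\varepsilon=[0,a)\cup(b,1]$. Let $\varpi(y)=\int_0^y\varpi'(z)\,dz$ for $y\in[0,1]$, where $\varpi'=-2$ on $S_\varepsilon$ and $\varpi'=0$ on $[a,b]$, and let $$\Psi_0'(y)=\int_0^y\varpi(z)\,dz-\int_0^1\int_0^{w}\varpi(z)\,dz\,dw-\tfrac13 .$$ For $0<\alpha<1$ let $C^{1+\alpha}_{0,\mathrm{even}}$ be the space of all $h\in C^{1+\alpha}(\mathbb T\times S_\varepsilon)$ with $h(x,0)=h(x,1)=0$ for all $x$, $\int_{\mathbb T}h(x,y)\,dx=0$ for all $y\in S_\varepsilon$, and $h(-x,y)=h(x,y)$. For $\lambda\in\mathbb R$ and $h\in C^{1+\alpha}_{0,\mathrm{even}}$ let $$\mathcal L^\lambda h(x,y)=(\lambda-\Psi_0'(y))\,h(x,y)-\varphi_h(x,y),\qquad (x,y)\in\mathbb T\times S_\varepsilon,$$ where $\varphi_h\in C^1(\mathbb T\times[0,1])$ is the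 unique weak solution of $\Delta\varphi_h=-\varpi' h$ on $\mathbb T\times(0,1)$ (the right-hand side being $0$ on $\mathbb T\times[a,b]$) with $\varphi_h=0$ on $\mathbb T\times\{0,1\}$. This $\mathcal L^\lambda: C^{1+\alpha}_{0,\mathrm{even}}\to C^{1+\alpha}_{0,\mathrm{even}}$ is the linearization at $f=0$ of the equation for the vorticity level curves $y+f(x,y)$ of traveling waves of speed $\lambda$ of the 2D Euler equation. **Theorem.** There is $\varepsilon_0\in(0,1]$ such that for every $0<\varepsilon<\varepsilon_0$ there is $\lambda^*=\lambda^*(\varepsilon)\in\mathbb R$ with the following properties. The function $\lambda^*-\Psi_0'(y)$ has no zeros in $[0,a]\cup[b,1]$. There is a nonzero function $h^*$ on $\mathbb T\times S_\varepsilon$ that extends to a function in $C^\infty(\mathbb T\times([0,a]\cup[b,1]))$, and for every $\alpha\in[\frac12,1)$ the kernel of $\mathcal L^{\lambda^*}$ on $C^{1+\alpha}_{0,\mathrm{even}}$ is one-dimensional and is spanned by $h^*$. -/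

import Mathlib

open scoped ContDiff

noncomputable section

namespace Poiseuille

/-- The torus `𝕋 = ℝ / 2πℤ`. -/
abbrev Torus : Type := AddCircle (2 * Real.pi)

/-- `a = (1 - ε) / 2`. -/
def aEps (ε : ℝ) : ℝ := 1 / 2 - ε / 2

/-- `b = (1 + ε) / 2`. -/
def bEps (ε : ℝ) : ℝ := 1 / 2 + ε / 2

/-- The set `[0,a) ∪ (b,1]` of heights on which the unknowns live, as a subset of `[0,1]`. -/
def dom (ε : ℝ) : Set ℝ := {y | y ∈ Set.Icc (0 : ℝ) 1 ∧ (y < aEps ε ∨ bEps ε < y)}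

/-- The closed set `[0,a] ∪ [b,1]`. -/
def closedDom (ε : ℝ) : Set ℝ := Set.Icc 0 (aEps ε) ∪ Set.Icc (bEps ε) 1

open Classical in
/-- A function on `𝕋 × K`, seen as a function on the plane, `2π`-periodic in the first variable
and extended by `0` to the points `(x, y)` with `y ∉ K`. -/
def lift (K : Set ℝ) (f : Torus × K → ℝ) (p : ℝ × ℝ) : ℝ :=
  if hp : p.2 ∈ K then f ((p.1 : Torus), ⟨p.2, hp⟩) else 0

/-! ### The profile and the background stream function -/

open Classical in
/-- The derivative `ϖ'` on `[0,1]`: it is `-2` on `[0,a) ∪ (b,1]` and `0` on `[a,b]`. -/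
def profileDeriv (ε y : ℝ) : ℝ := if y ∈ dom ε then -2 else 0

/-- The profile `ϖ(y) = ∫₀^y ϖ'`. -/
def profile (ε y : ℝ) : ℝ := ∫ z in (0 : ℝ)..y, profileDeriv ε z

/-- The derivative `Ψ₀'` of the background stream function, where `Ψ₀'' = ϖ` on `[0,1]`,
`Ψ₀(0) = 0`, `Ψ₀(1) = -1/3`. -/
def Psi0Deriv (ε y : ℝ) : ℝ :=
  (∫ z in (0 : ℝ)..y, profile ε z) - (∫ w in (0 : ℝ)..1, ∫ z in (0 : ℝ)..w, profile ε z) - 1 / 3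

/-! ### Function spaces -/

/-- `f ∈ C^{1+α}(𝕋 × K)`: `f` is differentiable on `𝕋 × K` (one-sidedly at boundary points that
belong to `K`), with an `α`-Hölder continuous derivative. For bounded `K` the
boundedness of `f` and of its derivative is automatic. -/
def IsC1Holder (α : ℝ) (K : Set ℝ) (f : Torus × K → ℝ) : Prop :=
  ∃ D : ℝ × ℝ → (ℝ × ℝ →L[ℝ] ℝ),
    (∀ p ∈ Set.univ ×ˢ K, HasFDerivWithinAt (lift K f) (D p) (Set.univ ×ˢ K) p) ∧
    ∃ C : ℝ, ∀ p ∈ Set.univ ×ˢ K, ∀ q ∈ Set.univ ×ˢ K, ‖D p - D q‖ ≤ C * dist p q ^ α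

/-- `f ∈ C¹(𝕋 × K)`. -/
def IsC1 (K : Set ℝ) (f : Torus × K → ℝ) : Prop :=
  ContDiffOn ℝ 1 (lift K f) (Set.univ ×ˢ K)

theorem lift_add (K : Set ℝ) (f g : Torus × K → ℝ) : lift K (f + g) = lift K f + lift K g := by
  funext p
  by_cases hp : p.2 ∈ K <;> simp [lift, hp]

theorem lift_smul (K : Set ℝ) (c : ℝ) (f : Torus × K → ℝ) : lift K (c • f) = c • lift K f := by
  funext p
  by_cases hp : p.2 ∈ K <;> simp [lift, hp]

theorem lift_zero (K : Set ℝ) : lift K (0 : Torus × K → ℝ) = 0 := by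
  funext p
  by_cases hp : p.2 ∈ K <;> simp [lift, hp]

theorem IsC1Holder.zero (α : ℝ) (K : Set ℝ) : IsC1Holder α K 0 := by
  refine ⟨0, fun p _ => ?_, 0, fun p _ q _ => by simp⟩
  rw [lift_zero]
  exact hasFDerivWithinAt_const (0 : ℝ) p _

theorem IsC1Holder.add {α : ℝ} {K : Set ℝ} {f g : Torus × K → ℝ}
    (hf : IsC1Holder α K f) (hg : IsC1Holder α K g) : IsC1Holder α K (f + g) := by
  obtain ⟨D, hD, C, hC⟩ := hf
  obtain ⟨E, hE, B, hB⟩ := hg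
  refine ⟨D + E, fun p hp => ?_, C + B, fun p hp q hq => ?_⟩
  · rw [lift_add]
    exact (hD p hp).add (hE p hp)
  · have h1 := hC p hp q hq
    have h2 := hB p hp q hq
    calc ‖(D + E) p - (D + E) q‖ = ‖(D p - D q) + (E p - E q)‖ := by
          simp only [Pi.add_apply]; congr 1; abel
      _ ≤ ‖D p - D q‖ + ‖E p - E q‖ := norm_add_le _ _
      _ ≤ (C + B) * dist p q ^ α := by rw [add_mul]; exact add_le_add h1 h2

theorem IsC1Holder.smul {α : ℝ} {K : Set ℝ} {f : Torus × K → ℝ} (c : ℝ)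
    (hf : IsC1Holder α K f) : IsC1Holder α K (c • f) := by
  obtain ⟨D, hD, C, hC⟩ := hf
  refine ⟨c • D, fun p hp => ?_, |c| * C, fun p hp q hq => ?_⟩
  · rw [lift_smul]
    exact (hD p hp).const_smul c
  · have h1 : (c • D) p - (c • D) q = c • (D p - D q) := (smul_sub c (D p) (D q)).symm
    rw [h1, norm_smul, Real.norm_eq_abs, mul_assoc]
    exact mul_le_mul_of_nonneg_left (hC p hp q hq) (abs_nonneg c)

theorem IsC1Holder.continuous_slice {α : ℝ} {K : Set ℝ} {f : Torus × K → ℝ}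
    (hf : IsC1Holder α K f) (y : K) : Continuous fun x : ℝ => f ((x : Torus), y) := by
  obtain ⟨D, hD, -⟩ := hf
  have hc : ContinuousOn (lift K f) (Set.univ ×ˢ K) :=
    fun p hp => (hD p hp).continuousWithinAt
  have h2 : Continuous fun x : ℝ => lift K f (x, (y : ℝ)) :=
    hc.comp_continuous (by fun_prop) (fun x => ⟨Set.mem_univ _, y.2⟩)
  simpa [lift, y.2] using h2

/-- The space `C^{1+α}_{0,even}` of all `f ∈ C^{1+α}(𝕋 × ([0,a) ∪ (b,1]))` with
`f(x,0) = f(x,1) = 0`, with zero mean in `x` for every `y`, and even in `x`. -/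
def holderSpace (α ε : ℝ) : Submodule ℝ (Torus × dom ε → ℝ) where
  carrier := {f | IsC1Holder α (dom ε) f ∧
    (∀ (x : Torus) (y : dom ε), ((y : ℝ) = 0 ∨ (y : ℝ) = 1) → f (x, y) = 0) ∧
    (∀ y : dom ε, ∫ x in (0 : ℝ)..(2 * Real.pi), f ((x : Torus), y) = 0) ∧
    (∀ (x : Torus) (y : dom ε), f (-x, y) = f (x, y))}
  add_mem' := by
    rintro f g ⟨f1, f2, f3, f4⟩ ⟨g1, g2, g3, g4⟩
    refine ⟨f1.add g1, fun x y h => by simp [f2 x y h, g2 x y h], fun y => ?_,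
      fun x y => by simp [f4 x y, g4 x y]⟩
    simp only [Pi.add_apply]
    rw [intervalIntegral.integral_add ((f1.continuous_slice y).intervalIntegrable _ _)
      ((g1.continuous_slice y).intervalIntegrable _ _), f3 y, g3 y, add_zero]
  zero_mem' := ⟨IsC1Holder.zero _ _, by simp, by simp, by simp⟩
  smul_mem' := by
    rintro c f ⟨f1, f2, f3, f4⟩
    exact ⟨f1.smul c, fun x y h => by simp [f2 x y h], fun y => by simp [f3 y],
      fun x y => by simp [f4 x y]⟩

/-- `h ∈ C^∞(𝕋 × ([0,a] ∪ [b,1]))`: the function `h` on `𝕋 × ([0,a) ∪ (b,1])` extends to a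
function that is smooth up to the boundary. (The extension is `2π`-periodic in `x` by
continuity.) -/
def SmoothUpToBoundary (ε : ℝ) (h : Torus × dom ε → ℝ) : Prop :=
  ∃ H : ℝ × ℝ → ℝ, ContDiffOn ℝ ∞ H (Set.univ ×ˢ closedDom ε) ∧
    ∀ (x : ℝ) (y : dom ε), H (x, (y : ℝ)) = h ((x : Torus), y)

/-! ### The linearized operator -/

/-- `φ` vanishes on `𝕋 × {0}` and on `𝕋 × {1}`. -/
def VanishesOnWalls (φ : Torus × Set.Icc (0 : ℝ) 1 → ℝ) : Prop :=
  ∀ (x : Torus) (y : Set.Icc (0 : ℝ) 1), ((y : ℝ) = 0 ∨ (y : ℝ) = 1) → φ (x, y) = 0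

/-- `∂ₓ f` for a function `f` on `𝕋 × [0,1]`. -/
def dx (f : Torus × Set.Icc (0 : ℝ) 1 → ℝ) (p : ℝ × ℝ) : ℝ :=
  fderivWithin ℝ (lift (Set.Icc 0 1) f) (Set.univ ×ˢ Set.Icc 0 1) p (1, 0)

/-- `∂_y f` for a function `f` on `𝕋 × [0,1]`. -/
def dy (f : Torus × Set.Icc (0 : ℝ) 1 → ℝ) (p : ℝ × ℝ) : ℝ :=
  fderivWithin ℝ (lift (Set.Icc 0 1) f) (Set.univ ×ˢ Set.Icc 0 1) p (0, 1)

/-- The first variation `dω₀` of the vorticity in the direction `h`: it is `-ϖ' h` on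
`𝕋 × ([0,a) ∪ (b,1])` and `0` on `𝕋 × [a,b]`. -/
def vorticityVariation (ε : ℝ) (h : Torus × dom ε → ℝ) (p : ℝ × ℝ) : ℝ :=
  -(profileDeriv ε p.2 * lift (dom ε) h p)

/-- `φ ∈ C¹(𝕋 × [0,1])` is the (weak) solution of the Dirichlet problem `Δφ = dω₀` in
`𝕋 × [0,1]`, `φ = 0` for `y = 0` and for `y = 1`. -/
structure IsStreamVariation (ε : ℝ) (h : Torus × dom ε → ℝ)
    (φ : Torus × Set.Icc (0 : ℝ) 1 → ℝ) : Prop where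
  isC1 : IsC1 (Set.Icc 0 1) φ
  boundary : VanishesOnWalls φ
  weak : ∀ η : Torus × Set.Icc (0 : ℝ) 1 → ℝ, IsC1 (Set.Icc 0 1) η → VanishesOnWalls η →
    (∫ x in (0 : ℝ)..(2 * Real.pi), ∫ y in (0 : ℝ)..1,
        (dx φ (x, y) * dx η (x, y) + dy φ (x, y) * dy η (x, y))) =
      -∫ x in (0 : ℝ)..(2 * Real.pi), ∫ y in (0 : ℝ)..1,
        vorticityVariation ε h (x, y) * lift (Set.Icc 0 1) η (x, y)

open Classical in
/-- The first variation `D_fΨ₀ h` of the stream function: the solution of the Dirichlet problem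
above (which is unique, and exists for every `h ∈ C^{1+α}_{0,even}`). -/
def streamVariation (ε : ℝ) (h : Torus × dom ε → ℝ) : Torus × Set.Icc (0 : ℝ) 1 → ℝ :=
  if hφ : ∃ φ, IsStreamVariation ε h φ then hφ.choose else 0

/-- The linearized operator
`𝓛^lam h (x,y) = (lam - Ψ₀'(y)) h(x,y) - (D_fΨ₀ h)(x,y)` on `𝕋 × ([0,a) ∪ (b,1])`. -/
def linearizedOp (ε lam : ℝ) (h : Torus × dom ε → ℝ) : Torus × dom ε → ℝ := fun p =>
  (lam - Psi0Deriv ε p.2) * h p - streamVariation ε h (p.1, ⟨p.2, p.2.2.1⟩)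

/-- The kernel `{h ∈ C^{1+α}_{0,even} : 𝓛^lam h = 0}`. -/
def kernel (α ε lam : ℝ) : Set (Torus × dom ε → ℝ) :=
  {h | h ∈ holderSpace α ε ∧ linearizedOp ε lam h = 0}

end Poiseuille

end

/-!
The kernel element is produced from a ground state of a one-dimensional Schrödinger operator.

On `𝓛^lam h = 0` one has `φ_h = (lam - Ψ₀') h` on the set where `ϖ' = -2`, so `φ = φ_h` solves
`Δφ = V(y) φ` with `V = 2 / (lam - Ψ₀')` there and `V = 0` in the gap `[a, b]`. The `k`-th cosine
coefficient of `φ` then solves `φ_k'' = (k² + V) φ_k` with Dirichlet conditions. If for some `lam`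
the lowest eigenvalue of `-d²/dy² + V` is exactly `-1`, with positive eigenfunction `φ`, then the
mode `k = 1` contributes the multiples of `φ(y) cos x`, and no mode `k ≥ 2` contributes since `-k²`
lies below the spectrum. This comparison is a Picone inequality, `IsGroundState.form_nonneg` with
the case of equality `IsGroundState.eq_smul_of_form_eq_zero`; the mode `k = 0` vanishes on the
domain of `h` because `h` has zero mean. Hence the kernel is spanned by
`φ(y) cos x / (lam - Ψ₀'(y))` (`IsGroundState.kernel_eq`).

Such a `lam` exists for every `0 < ε < 1` (`exists_groundState`): it is found by shooting, with
`lam` in the range of `Ψ₀'` over the gap, so that `lam - Ψ₀'` vanishes only inside the gap. The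
potential is attractive on the left of the gap and repulsive on the right of it. As
`lam → Ψ₀'(a)`, the left part becomes non-integrably attractive and the logarithmic derivative at
`a` of the solution started at `0` tends to `-∞` (`left_slope_lt`). As `lam → Ψ₀'(b)`, the right
part becomes non-integrably repulsive, the logarithmic derivative at `b` of the solution started
at `1` tends to `-∞` (`lt_right_slope`), while on the left the solution stays above the one given by
`Ψ₀' - lam`, which satisfies `u'' = V u`. The matching condition across the gap
therefore changes sign (`exists_matching`). Continuity in `lam` comes from constructing the solutions
jointly in the parameter and in `y` by a contraction (`exists_linear_flow`).
-/

namespace Poiseuille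

open scoped BoundedContinuousFunction
open Set Filter Topology MeasureTheory

/-! ### Linear systems depending on a parameter -/

/-- The Volterra operator with exponential kernel has norm at most `1 / M`; this is what makes the
Picard map a contraction on the whole half-line. -/
theorem norm_integral_exp_smul_le {E : Type*} [NormedAddCommGroup E] [NormedSpace ℝ E]
    {f : ℝ → E} {M C y : ℝ} (hM : 0 < M) (hC : 0 ≤ C) (hy : 0 ≤ y) (hf : ∀ r, ‖f r‖ ≤ C) :
    ‖Real.exp (-(M * y)) • ∫ r in (0 : ℝ)..y, Real.exp (M * r) • f r‖ ≤ C / M := by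
  have h1 : ‖∫ r in (0 : ℝ)..y, Real.exp (M * r) • f r‖ ≤ ∫ r in (0 : ℝ)..y, C * Real.exp (M * r) := by
    refine intervalIntegral.norm_integral_le_of_norm_le hy (ae_of_all _ fun r _ => ?_)
      (Continuous.intervalIntegrable (by fun_prop) _ _)
    rw [norm_smul, Real.norm_eq_abs, Real.abs_exp, mul_comm]
    exact mul_le_mul_of_nonneg_right (hf r) (Real.exp_pos _).le
  have h2 : ∫ r in (0 : ℝ)..y, C * Real.exp (M * r) = C / M * (Real.exp (M * y) - 1) := by
    rw [intervalIntegral.integral_const_mul, intervalIntegral.integral_comp_mul_left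
      (fun r => Real.exp r) hM.ne', integral_exp]
    simp; ring
  rw [norm_smul, Real.norm_eq_abs, Real.abs_exp]
  calc _ ≤ Real.exp (-(M * y)) * (C / M * (Real.exp (M * y) - 1)) := by
        rw [← h2]; exact mul_le_mul_of_nonneg_left h1 (Real.exp_pos _).le
    _ = C / M * (1 - Real.exp (-(M * y))) := by
        have : Real.exp (-(M * y)) * Real.exp (M * y) = 1 := by rw [← Real.exp_add]; simp
        linear_combination (C / M) * this
    _ ≤ C / M := by
        have : 0 ≤ C / M := by positivity
        nlinarith [Real.exp_pos (-(M * y))]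

/-- A linear system with bounded coefficients, jointly continuous in the parameter `s` and in time,
has solutions on the half-line that are jointly continuous in `(s, y)`. The parameter is carried
along in the space on which the contraction acts, so that continuity in `s` needs no separate proof. -/
theorem exists_linear_flow {E : Type*} [NormedAddCommGroup E] [NormedSpace ℝ E] [CompleteSpace E]
    (B : ℝ → ℝ → E →L[ℝ] E) (hB : Continuous (Function.uncurry B)) (K : ℝ)
    (hK : ∀ s r, ‖B s r‖ ≤ K) (v : E) :
    ∃ Y : ℝ → ℝ → E, Continuous (Function.uncurry Y) ∧ (∀ s, Y s 0 = v) ∧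
      ∀ s y, 0 ≤ y → HasDerivAt (Y s) (B s y (Y s y)) y := by
  have hK0 : 0 ≤ K := (norm_nonneg _).trans (hK 0 0)
  obtain ⟨M, hM⟩ : ∃ M : ℝ, M = 2 * K + 1 := ⟨_, rfl⟩
  have hM0 : 0 < M := by rw [hM]; positivity
  have hint : ∀ F : ℝ × ℝ →ᵇ E, Continuous
      (Function.uncurry fun (s : ℝ) (r : ℝ) => Real.exp (M * r) • B s r (F (s, r))) := by
    intro F
    have h1 : Continuous fun p : ℝ × ℝ => B p.1 p.2 (F (p.1, p.2)) :=
      Continuous.clm_apply hB (F.continuous)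
    have h2 : Continuous fun p : ℝ × ℝ => Real.exp (M * p.2) := by fun_prop
    exact h2.smul h1
  have hprim : ∀ F : ℝ × ℝ →ᵇ E, Continuous fun p : ℝ × ℝ =>
      ∫ r in (0 : ℝ)..p.2, Real.exp (M * r) • B p.1 r (F (p.1, r)) := fun F =>
    intervalIntegral.continuous_parametric_primitive_of_continuous (hint F)
  have hBF : ∀ (F : ℝ × ℝ →ᵇ E) s r, ‖B s r (F (s, r))‖ ≤ K * ‖F‖ := fun F s r =>
    (ContinuousLinearMap.le_opNorm _ _).trans
      (mul_le_mul (hK s r) (F.norm_coe_le_norm _) (norm_nonneg _) hK0)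
  let T : (ℝ × ℝ →ᵇ E) → (ℝ × ℝ →ᵇ E) := fun F =>
    BoundedContinuousFunction.ofNormedAddCommGroup
      (fun p : ℝ × ℝ => Real.exp (-(M * max p.2 0)) • (v +
        ∫ r in (0 : ℝ)..(max p.2 0), Real.exp (M * r) • B p.1 r (F (p.1, r))))
      (by
        have h1 : Continuous fun p : ℝ × ℝ => (p.1, max p.2 0) := by fun_prop
        have h2 := (hprim F).comp h1
        have h3 : Continuous fun p : ℝ × ℝ => Real.exp (-(M * max p.2 0)) := by fun_prop
        exact h3.smul (continuous_const.add h2))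
      (‖v‖ + K * ‖F‖ / M)
      (by
        intro p
        rw [smul_add]
        refine (norm_add_le _ _).trans (add_le_add ?_ (norm_integral_exp_smul_le hM0 (by positivity)
          (le_max_right _ _) (hBF F p.1)))
        rw [norm_smul, Real.norm_eq_abs, Real.abs_exp]
        refine mul_le_of_le_one_left (norm_nonneg _) (Real.exp_le_one_iff.2 ?_)
        have := le_max_right p.2 0
        nlinarith)
  have hT : ∀ F p, T F p = Real.exp (-(M * max p.2 0)) • (v +
        ∫ r in (0 : ℝ)..(max p.2 0), Real.exp (M * r) • B p.1 r (F (p.1, r))) := fun F p => rfl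
  -- `T` is the Picard map for `exp (-M y) Y(s, y)`, with the time `y` clamped to `[0, ∞)`
  have hLip : ∀ F G, dist (T F) (T G) ≤ (1 / 2 : NNReal) * dist F G := by
    intro F G
    rw [BoundedContinuousFunction.dist_le (by positivity)]
    intro p
    rw [dist_eq_norm, hT, hT, ← smul_sub, add_sub_add_left_eq_sub,
      ← intervalIntegral.integral_sub]
    · simp_rw [← smul_sub, ← map_sub]
      refine (norm_integral_exp_smul_le hM0 (C := K * dist F G) (by positivity)
        (le_max_right _ _) fun r => ?_).trans ?_
      · rw [dist_eq_norm]; exact hBF (F - G) p.1 r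
      · rw [div_le_iff₀ hM0, hM]
        push_cast
        nlinarith [dist_nonneg (x := F) (y := G)]
    · exact ((hint F).comp (Continuous.prodMk_right p.1)).intervalIntegrable _ _
    · exact ((hint G).comp (Continuous.prodMk_right p.1)).intervalIntegrable _ _
  have hc : ContractingWith (1 / 2 : NNReal) T :=
    ⟨by rw [← NNReal.coe_lt_coe]; norm_num, LipschitzWith.of_dist_le_mul hLip⟩
  obtain ⟨F, hF⟩ : ∃ F, T F = F := ⟨_, hc.fixedPoint_isFixedPt⟩
  refine ⟨fun s y => v + ∫ r in (0 : ℝ)..y, Real.exp (M * r) • B s r (F (s, r)),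
    continuous_const.add (hprim F), fun s => by simp, fun s y hy => ?_⟩
  have hFy : v + ∫ r in (0 : ℝ)..y, Real.exp (M * r) • B s r (F (s, r))
      = Real.exp (M * y) • F (s, y) := by
    conv_rhs => rw [← hF, hT]
    simp only [max_eq_left hy]
    rw [smul_smul, ← Real.exp_add]; simp
  have hcont : Continuous fun r => Real.exp (M * r) • B s r (F (s, r)) :=
    (hint F).comp (Continuous.prodMk_right s)
  have := (intervalIntegral.integral_hasDerivAt_right (hcont.intervalIntegrable 0 y)
    (hcont.stronglyMeasurableAtFilter _ _) hcont.continuousAt).const_add v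
  simp only at hFy ⊢
  rw [hFy, map_smul]
  exact this

/-- The flow of `g' = α p`, `p' = β g` with `g(0) = 0`, `p(0) = 1`. Both shooting problems have this
form. -/
theorem exists_system_flow (α β : ℝ → ℝ → ℝ) (hα : Continuous (Function.uncurry α))
    (hβ : Continuous (Function.uncurry β)) (K : ℝ) (hαK : ∀ s r, |α s r| ≤ K)
    (hβK : ∀ s r, |β s r| ≤ K) :
    ∃ g p : ℝ → ℝ → ℝ, Continuous (Function.uncurry g) ∧ Continuous (Function.uncurry p) ∧
      (∀ s, g s 0 = 0) ∧ (∀ s, p s 0 = 1) ∧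
      (∀ s y, 0 ≤ y → HasDerivAt (g s) (α s y * p s y) y) ∧
      ∀ s y, 0 ≤ y → HasDerivAt (p s) (β s y * g s y) y := by
  let P : ℝ × ℝ →L[ℝ] ℝ × ℝ := (ContinuousLinearMap.snd ℝ ℝ ℝ).prod 0
  let Q : ℝ × ℝ →L[ℝ] ℝ × ℝ := (0 : ℝ × ℝ →L[ℝ] ℝ).prod (ContinuousLinearMap.fst ℝ ℝ ℝ)
  obtain ⟨Y, hY, hY0, hYd⟩ := exists_linear_flow (fun s r => α s r • P + β s r • Q)
    (by
      have h1 : Continuous fun p : ℝ × ℝ => α p.1 p.2 • P := Continuous.smul hα continuous_const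
      have h2 : Continuous fun p : ℝ × ℝ => β p.1 p.2 • Q := Continuous.smul hβ continuous_const
      exact h1.add h2) K
    (by
      intro s r
      have hK0 : 0 ≤ K := (abs_nonneg _).trans (hαK s r)
      refine ContinuousLinearMap.opNorm_le_bound _ hK0 fun w => ?_
      have : (α s r • P + β s r • Q) w = (α s r * w.2, β s r * w.1) := by simp [P, Q]
      rw [this, Prod.norm_def, Prod.norm_def]
      refine max_le ?_ ?_
      · rw [norm_mul]
        exact mul_le_mul (hαK s r) (le_max_right _ _) (norm_nonneg _) hK0
      · rw [norm_mul]
        exact mul_le_mul (hβK s r) (le_max_left _ _) (norm_nonneg _) hK0) ((0, 1) : ℝ × ℝ)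
  refine ⟨fun s y => (Y s y).1, fun s y => (Y s y).2, continuous_fst.comp hY,
    continuous_snd.comp hY, fun s => by simp [hY0], fun s => by simp [hY0], fun s y hy => ?_,
    fun s y hy => ?_⟩
  · have h1 : HasDerivAt (fun y => (Y s y).1) _ y :=
      ((ContinuousLinearMap.fst ℝ ℝ ℝ).hasFDerivAt).comp_hasDerivAt y (hYd s y hy)
    refine h1.congr_deriv ?_
    simp [P, Q]
  · have h1 : HasDerivAt (fun y => (Y s y).2) _ y :=
      ((ContinuousLinearMap.snd ℝ ℝ ℝ).hasFDerivAt).comp_hasDerivAt y (hYd s y hy)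
    refine h1.congr_deriv ?_
    simp [P, Q]

/-- For nonnegative coefficients the solution stays in the positive quadrant: `g p` and `p²` are
nondecreasing, hence `p` cannot vanish. -/
theorem system_pos {α β g p : ℝ → ℝ} {ℓ : ℝ} (hα : ∀ y ∈ Icc 0 ℓ, 0 < α y)
    (hβ : ∀ y ∈ Icc 0 ℓ, 0 ≤ β y) (g0 : g 0 = 0) (p0 : p 0 = 1)
    (hg : ∀ y ∈ Icc 0 ℓ, HasDerivAt g (α y * p y) y)
    (hp : ∀ y ∈ Icc 0 ℓ, HasDerivAt p (β y * g y) y) :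
    (∀ y ∈ Icc 0 ℓ, 0 < p y) ∧ (∀ y ∈ Ioc 0 ℓ, 0 < g y) := by
  have hgc : ContinuousOn g (Icc 0 ℓ) := fun y hy => (hg y hy).continuousAt.continuousWithinAt
  have hpc : ContinuousOn p (Icc 0 ℓ) := fun y hy => (hp y hy).continuousAt.continuousWithinAt
  have hgp : MonotoneOn (fun y => g y * p y) (Icc 0 ℓ) := by
    refine monotoneOn_of_hasDerivWithinAt_nonneg (convex_Icc _ _) (hgc.mul hpc)
      (fun y hy => ((hg y (interior_subset hy)).mul (hp y (interior_subset hy))).hasDerivWithinAt)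
      fun y hy => ?_
    have h1 := hα y (interior_subset hy)
    have h2 := hβ y (interior_subset hy)
    have : α y * p y * p y + g y * (β y * g y) = α y * p y ^ 2 + β y * g y ^ 2 := by ring
    rw [this]; positivity
  have hgp0 : ∀ y ∈ Icc 0 ℓ, 0 ≤ g y * p y := fun y hy => by
    have := hgp ⟨le_rfl, hy.1.trans hy.2⟩ hy hy.1
    simpa [g0] using this
  have hpp : MonotoneOn (fun y => p y * p y) (Icc 0 ℓ) := by
    refine monotoneOn_of_hasDerivWithinAt_nonneg (convex_Icc _ _) (hpc.mul hpc)
      (fun y hy => ((hp y (interior_subset hy)).mul (hp y (interior_subset hy))).hasDerivWithinAt)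
      fun y hy => ?_
    have h1 := hgp0 y (interior_subset hy)
    have h2 := hβ y (interior_subset hy)
    have : β y * g y * p y + p y * (β y * g y) = 2 * (β y * (g y * p y)) := by ring
    rw [this]; positivity
  have hppos : ∀ y ∈ Icc 0 ℓ, 0 < p y := by
    intro y hy
    by_contra hneg
    push Not at hneg
    have hsub : Icc 0 y ⊆ Icc 0 ℓ := Icc_subset_Icc_right hy.2
    obtain ⟨z, hz, hz0⟩ : (0 : ℝ) ∈ p '' Icc 0 y :=
      intermediate_value_Icc' hy.1 (hpc.mono hsub) ⟨hneg, by simp [p0]⟩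
    have := hpp ⟨le_rfl, hy.1.trans hy.2⟩ (hsub hz) hz.1
    simp [p0, hz0] at this
    linarith
  refine ⟨hppos, fun y hy => ?_⟩
  have hmono : StrictMonoOn g (Icc 0 ℓ) := by
    refine strictMonoOn_of_hasDerivWithinAt_pos (convex_Icc _ _) hgc
      (fun y hy => (hg y (interior_subset hy)).hasDerivWithinAt) fun y hy => ?_
    exact mul_pos (hα y (interior_subset hy)) (hppos y (interior_subset hy))
  have := hmono ⟨le_rfl, hy.1.le.trans hy.2⟩ ⟨hy.1.le, hy.2⟩ hy.1
  rwa [g0] at this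

/-! ### The background profile -/

theorem measurableSet_dom (ε : ℝ) : MeasurableSet (dom ε) := by
  have : dom ε = Icc 0 1 ∩ (Iio (aEps ε) ∪ Ioi (bEps ε)) := by
    ext y; simp [dom]
  rw [this]
  exact measurableSet_Icc.inter (measurableSet_Iio.union measurableSet_Ioi)

theorem measurable_profileDeriv (ε : ℝ) : Measurable (profileDeriv ε) := by
  classical
  unfold profileDeriv
  exact Measurable.ite (measurableSet_dom ε) measurable_const measurable_const

theorem intervalIntegrable_profileDeriv (ε u v : ℝ) :
    IntervalIntegrable (profileDeriv ε) volume u v := by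
  refine (intervalIntegrable_const (c := (2 : ℝ))).mono_fun
    (measurable_profileDeriv ε).aestronglyMeasurable (ae_of_all _ fun y => ?_)
  simp only [profileDeriv]
  split_ifs <;> simp

/-- `ϖ` is `-2y` up to `a`, constant in the gap, and has slope `-2` again beyond `b`. -/
theorem profile_eq {ε : ℝ} (h0 : 0 < ε) (h1 : ε < 1) {y : ℝ} (hy : y ∈ Icc (0 : ℝ) 1) :
    profile ε y = -2 * min y (aEps ε) - 2 * max (y - bEps ε) 0 := by
  have hab : aEps ε < bEps ε := by unfold aEps bEps; linarith
  have ha : 0 < aEps ε := by unfold aEps; linarith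
  have hb : bEps ε < 1 := by unfold bEps; linarith
  unfold profile
  rw [integral_eq_of_hasDerivAt_off_countable_of_le
    (fun z => -2 * min z (aEps ε) - 2 * max (z - bEps ε) 0) (profileDeriv ε) hy.1
    (s := {aEps ε, bEps ε}) ((finite_singleton _).insert _).countable
    (by fun_prop) _ (intervalIntegrable_profileDeriv ε _ _)]
  · have e1 : min 0 (aEps ε) = 0 := min_eq_left ha.le
    have e2 : max (0 - bEps ε) 0 = 0 := max_eq_right (by linarith)
    simp only [e1, e2]; ring
  · rintro z ⟨hz, hz'⟩
    simp only [mem_insert_iff, mem_singleton_iff, not_or] at hz'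
    obtain ⟨hza, hzb⟩ := hz'
    have hz1 : z ≤ 1 := hz.2.le.trans hy.2
    rcases lt_or_gt_of_ne hza with hlt | hgt
    · have hd : profileDeriv ε z = -2 := by
        unfold profileDeriv; rw [if_pos ⟨⟨hz.1.le, hz1⟩, Or.inl hlt⟩]
      rw [hd]
      have : HasDerivAt (fun z : ℝ => -2 * z) (-2) z := by
        simpa using (hasDerivAt_id z).const_mul (-2 : ℝ)
      refine this.congr_of_eventuallyEq ?_
      filter_upwards [Iio_mem_nhds hlt] with w hw
      rw [mem_Iio] at hw
      rw [min_eq_left hw.le, max_eq_right (by linarith)]; ring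
    · rcases lt_or_gt_of_ne hzb with hlt' | hgt'
      · have hd : profileDeriv ε z = 0 := by
          unfold profileDeriv; rw [if_neg]
          rintro ⟨-, h | h⟩ <;> linarith
        rw [hd]
        refine (hasDerivAt_const z (-2 * aEps ε)).congr_of_eventuallyEq ?_
        filter_upwards [Ioo_mem_nhds hgt hlt'] with w hw
        rw [min_eq_right hw.1.le, max_eq_right (by linarith [hw.2])]; ring
      · have hd : profileDeriv ε z = -2 := by
          unfold profileDeriv; rw [if_pos ⟨⟨hz.1.le, hz1⟩, Or.inr hgt'⟩]
        rw [hd]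
        have : HasDerivAt (fun z : ℝ => -2 * aEps ε - 2 * (z - bEps ε)) (-2) z := by
          simpa using (((hasDerivAt_id z).sub_const (bEps ε)).const_mul (2 : ℝ)).const_sub
            (-2 * aEps ε)
        refine this.congr_of_eventuallyEq ?_
        filter_upwards [Ioi_mem_nhds hgt'] with w hw
        rw [mem_Ioi] at hw
        rw [min_eq_right (by linarith), max_eq_left (by linarith)]

theorem Psi0Deriv_sub {ε : ℝ} (h0 : 0 < ε) (h1 : ε < 1) {y z : ℝ} (hy : y ∈ Icc (0 : ℝ) 1)
    (hz : z ∈ Icc (0 : ℝ) 1) : Psi0Deriv ε z - Psi0Deriv ε y = ∫ w in y..z, profile ε w := by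
  have hi : ∀ u ∈ Icc (0 : ℝ) 1, IntervalIntegrable (profile ε) volume 0 u := by
    intro u hu
    refine ContinuousOn.intervalIntegrable ?_
    rw [uIcc_of_le hu.1]
    refine ContinuousOn.congr
      (f := fun z => -2 * min z (aEps ε) - 2 * max (z - bEps ε) 0) (by fun_prop) fun w hw => ?_
    exact profile_eq h0 h1 ⟨hw.1, hw.2.trans hu.2⟩
  unfold Psi0Deriv
  rw [← intervalIntegral.integral_interval_sub_left (hi z hz) (hi y hy)]
  ring

theorem Psi0Deriv_left {ε : ℝ} (h0 : 0 < ε) (h1 : ε < 1) {y : ℝ} (hy : y ∈ Icc 0 (aEps ε)) :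
    Psi0Deriv ε y = Psi0Deriv ε (aEps ε) + (aEps ε ^ 2 - y ^ 2) := by
  have ha1 : aEps ε < 1 := by unfold aEps; linarith
  have hab : aEps ε < bEps ε := by unfold aEps bEps; linarith
  have h := Psi0Deriv_sub h0 h1 (y := y) (z := aEps ε) ⟨hy.1, by linarith [hy.2]⟩
    ⟨by linarith [hy.1, hy.2], ha1.le⟩
  have h2 : ∫ w in y..aEps ε, profile ε w = ∫ w in y..aEps ε, (-2 : ℝ) * w := by
    refine intervalIntegral.integral_congr fun w hw => ?_
    rw [uIcc_of_le hy.2] at hw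
    rw [profile_eq h0 h1 ⟨hy.1.trans hw.1, hw.2.trans ha1.le⟩, min_eq_left hw.2,
      max_eq_right (by linarith [hw.2])]
    ring
  rw [h2, intervalIntegral.integral_const_mul, integral_id] at h
  linarith

theorem Psi0Deriv_gap {ε : ℝ} (h0 : 0 < ε) (h1 : ε < 1) :
    Psi0Deriv ε (aEps ε) = Psi0Deriv ε (bEps ε) + 2 * aEps ε * ε := by
  have ha : 0 < aEps ε := by unfold aEps; linarith
  have hb1 : bEps ε < 1 := by unfold bEps; linarith
  have hab : aEps ε < bEps ε := by unfold aEps bEps; linarith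
  have h := Psi0Deriv_sub h0 h1 (y := aEps ε) (z := bEps ε) ⟨ha.le, by linarith⟩
    ⟨by linarith, hb1.le⟩
  have h2 : ∫ w in aEps ε..bEps ε, profile ε w = ∫ w in aEps ε..bEps ε, (-2 : ℝ) * aEps ε := by
    refine intervalIntegral.integral_congr fun w hw => ?_
    rw [uIcc_of_le hab.le] at hw
    rw [profile_eq h0 h1 ⟨ha.le.trans hw.1, hw.2.trans hb1.le⟩, min_eq_right hw.1,
      max_eq_right (by linarith [hw.2])]
    ring
  rw [h2, intervalIntegral.integral_const] at h
  have : bEps ε - aEps ε = ε := by unfold aEps bEps; ring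
  rw [this, smul_eq_mul] at h
  linarith

theorem Psi0Deriv_right {ε : ℝ} (h0 : 0 < ε) (h1 : ε < 1) {y : ℝ} (hy : y ∈ Icc (bEps ε) 1) :
    Psi0Deriv ε y
      = Psi0Deriv ε (bEps ε) - (2 * aEps ε * (y - bEps ε) + (y - bEps ε) ^ 2) := by
  have hb0 : 0 < bEps ε := by unfold bEps; linarith
  have hb1 : bEps ε < 1 := by unfold bEps; linarith
  have hab : aEps ε < bEps ε := by unfold aEps bEps; linarith
  have h := Psi0Deriv_sub h0 h1 (y := bEps ε) (z := y) ⟨hb0.le, hb1.le⟩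
    ⟨by linarith [hy.1], hy.2⟩
  have h2 : ∫ w in bEps ε..y, profile ε w
      = ∫ w in bEps ε..y, ((-2 : ℝ) * aEps ε + 2 * bEps ε + (-2) * w) := by
    refine intervalIntegral.integral_congr fun w hw => ?_
    rw [uIcc_of_le hy.1] at hw
    rw [profile_eq h0 h1 ⟨hb0.le.trans hw.1, hw.2.trans hy.2⟩,
      min_eq_right (by linarith [hw.1]), max_eq_left (by linarith [hw.1])]
    ring
  rw [h2, intervalIntegral.integral_add (by simp) (Continuous.intervalIntegrable (by fun_prop) _ _),
    intervalIntegral.integral_const_mul, integral_id, intervalIntegral.integral_const,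
    smul_eq_mul] at h
  linarith

/-! ### Logarithmic derivatives at the edges of the gap -/

/-- `φ` solves `φ'' = q φ` on `[0, ℓ]` with `φ(0) = 0`, and is positive on `(0, ℓ]`; `ψ` is its
derivative. Derivatives are two-sided also at the endpoints. -/
structure IsPositiveSolution (ℓ : ℝ) (q φ ψ : ℝ → ℝ) : Prop where
  zero : φ 0 = 0
  deriv : ∀ y ∈ Icc 0 ℓ, HasDerivAt φ (ψ y) y
  deriv' : ∀ y ∈ Icc 0 ℓ, HasDerivAt ψ (q y * φ y) y
  pos : ∀ y ∈ Ioc 0 ℓ, 0 < φ y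

/-- The coefficient `1 + V` on the left of the gap, where `Ψ₀'(y) - lam = d + a² - y²`. -/
noncomputable def leftPotential (a d y : ℝ) : ℝ := 1 - 2 / (d + (a ^ 2 - y ^ 2))

/-- The coefficient `1 + V` on the right of the gap, in the reflected variable `z = 1 - y ∈ [0, a]`,
where `lam - Ψ₀' = s + 2a(a - z) + (a - z)²`. -/
noncomputable def rightPotential (a s z : ℝ) : ℝ := 1 + 2 / (s + (2 * a * (a - z) + (a - z) ^ 2))

theorem IsPositiveSolution.nonneg {ℓ : ℝ} {q φ ψ : ℝ → ℝ} (h : IsPositiveSolution ℓ q φ ψ)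
    {y : ℝ} (hy : y ∈ Icc 0 ℓ) : 0 ≤ φ y := by
  rcases hy.1.eq_or_lt with h0 | h0
  · rw [← h0, h.zero]
  · exact (h.pos y ⟨h0, hy.2⟩).le

theorem IsPositiveSolution.continuousOn {ℓ : ℝ} {q φ ψ : ℝ → ℝ}
    (h : IsPositiveSolution ℓ q φ ψ) : ContinuousOn φ (Icc 0 ℓ) :=
  fun y hy => (h.deriv y hy).continuousAt.continuousWithinAt

theorem IsPositiveSolution.continuousOn' {ℓ : ℝ} {q φ ψ : ℝ → ℝ}
    (h : IsPositiveSolution ℓ q φ ψ) : ContinuousOn ψ (Icc 0 ℓ) :=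
  fun y hy => (h.deriv' y hy).continuousAt.continuousWithinAt

/-- As `d → 0` the logarithmic derivative `ψ(a) / φ(a)` of the left solution tends to `-∞`, like
`log d / a`. -/
theorem left_slope_lt {a : ℝ} (ha : 0 < a) (ha' : a < 1 / 2) (N : ℝ) :
    ∃ d₀ > 0, ∀ d, 0 < d → d < d₀ → ∀ φ ψ, IsPositiveSolution a (leftPotential a d) φ ψ →
      ψ a < -N * φ a := by
  refine ⟨min 1 (a ^ 2 * Real.exp (-(2 + a ^ 2 / 2 + a * N))), by positivity, ?_⟩
  intro d hd hd0 φ ψ h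
  have hd1 : d < 1 := hd0.trans_le (min_le_left _ _)
  have hd2 : Real.log d < Real.log (a ^ 2) - (2 + a ^ 2 / 2 + a * N) := by
    rw [Real.log_lt_iff_lt_exp hd, sub_eq_add_neg, Real.exp_add, Real.exp_log (by positivity)]
    exact hd0.trans_le (min_le_right _ _)
  have hu : ∀ y ∈ Icc 0 a, 0 < d + (a ^ 2 - y ^ 2) ∧ d + (a ^ 2 - y ^ 2) ≤ 2 := by
    intro y hy
    constructor <;> nlinarith [hy.1, hy.2]
  -- the solution is concave, hence `φ ≥ y ψ`, which bounds the slope at `a / 2`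
  have hconc : MonotoneOn (fun y => φ y - y * ψ y) (Icc 0 a) := by
    refine monotoneOn_of_hasDerivWithinAt_nonneg (convex_Icc _ _)
      (h.continuousOn.sub (continuousOn_id.mul h.continuousOn'))
      (fun y hy => ((h.deriv y (interior_subset hy)).sub ((hasDerivAt_id y).mul
        (h.deriv' y (interior_subset hy)))).hasDerivWithinAt) fun y hy => ?_
    have hy' := interior_subset hy
    have h1 : leftPotential a d y ≤ 0 := by
      unfold leftPotential
      rw [sub_nonpos, le_div_iff₀ (hu y hy').1]; linarith [(hu y hy').2]
    have h2 := mul_nonneg (mul_nonneg (neg_nonneg.2 h1) (h.nonneg hy')) hy'.1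
    simp only [id]
    linarith
  have hhalf : a / 2 ∈ Icc 0 a := ⟨by linarith, by linarith⟩
  have hpos : ∀ y ∈ Icc (a / 2) a, 0 < φ y := fun y hy => h.pos y ⟨by linarith [hy.1], hy.2⟩
  have hsub : Icc (a / 2) a ⊆ Icc 0 a := Icc_subset_Icc_left (by linarith)
  have hm : ψ (a / 2) / φ (a / 2) ≤ 2 / a := by
    have := hconc ⟨le_rfl, ha.le⟩ hhalf hhalf.1
    simp only [h.zero] at this
    rw [div_le_div_iff₀ (hpos _ ⟨le_rfl, hhalf.2⟩) ha]
    linarith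
  -- the Riccati equation `m' = 1 + V - m²` for `m = ψ / φ`, compared with an explicit primitive
  have hanti : AntitoneOn (fun y => ψ y / φ y - y - 1 / a * Real.log (d + 2 * a * (a - y)))
      (Icc (a / 2) a) := by
    have hder : ∀ y ∈ Icc (a / 2) a, HasDerivAt
        (fun y => ψ y / φ y - y - 1 / a * Real.log (d + 2 * a * (a - y)))
        ((leftPotential a d y * φ y * φ y - ψ y * ψ y) / φ y ^ 2 - 1
          - 1 / a * ((2 * a * -1) / (d + 2 * a * (a - y)))) y := by
      intro y hy
      have hl : 0 < d + 2 * a * (a - y) := by nlinarith [hy.2]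
      have h1 := (h.deriv' y (hsub hy)).div (h.deriv y (hsub hy)) (hpos y hy).ne'
      have h2 : HasDerivAt (fun y => d + 2 * a * (a - y)) (2 * a * -1) y :=
        (((hasDerivAt_id y).const_sub a).const_mul (2 * a)).const_add d
      exact (h1.sub (hasDerivAt_id y)).sub ((h2.log hl.ne').const_mul _)
    refine antitoneOn_of_hasDerivWithinAt_nonpos (convex_Icc _ _)
      (fun y hy => (hder y hy).continuousAt.continuousWithinAt)
      (fun y hy => (hder y (interior_subset hy)).hasDerivWithinAt) fun y hy => ?_
    have hy' := interior_subset hy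
    have hl : 0 < d + 2 * a * (a - y) := by nlinarith [hy'.2]
    have hp := hpos y hy'
    have e1 : (leftPotential a d y * φ y * φ y - ψ y * ψ y) / φ y ^ 2
        = leftPotential a d y - (ψ y / φ y) ^ 2 := by field_simp
    have e2 : 1 / a * ((2 * a * -1) / (d + 2 * a * (a - y))) = -(2 / (d + 2 * a * (a - y))) := by
      field_simp
    have e3 : 2 / (d + 2 * a * (a - y)) ≤ 2 / (d + (a ^ 2 - y ^ 2)) := by
      refine div_le_div_of_nonneg_left (by norm_num) (hu y (hsub hy')).1 ?_
      nlinarith [hy'.2, hy'.1]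
    rw [e1, e2]
    unfold leftPotential
    nlinarith [sq_nonneg (ψ y / φ y)]
  have hfin := hanti ⟨le_rfl, by linarith⟩ ⟨by linarith, le_rfl⟩ (by linarith : a / 2 ≤ a)
  simp only at hfin
  have e1 : d + 2 * a * (a - a) = d := by ring
  have e2 : Real.log (a ^ 2) ≤ Real.log (d + 2 * a * (a - a / 2)) :=
    Real.log_le_log (by positivity) (by nlinarith)
  rw [e1] at hfin
  have hpa := hpos a ⟨by linarith, le_rfl⟩
  have e3 : 1 / a * (Real.log (d + 2 * a * (a - a / 2)) - Real.log d)
      > 1 / a * (2 + a ^ 2 / 2 + a * N) :=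
    mul_lt_mul_of_pos_left (by linarith) (by positivity)
  have e4 : 1 / a * (2 + a ^ 2 / 2 + a * N) = 2 / a + a / 2 + N := by field_simp
  have : ψ a / φ a < -N := by linarith
  rwa [div_lt_iff₀ hpa] at this

/-- As `s → 0` the logarithmic derivative `ψ(a) / φ(a)` of the right solution tends to `+∞`. If it
stayed below `N`, convexity would keep `φ` above `φ(a) / 2` on an interval of length `1 / (2N)`
before `a`, and the integral of `2 / (lam - Ψ₀')` over it diverges as `s → 0`. -/
theorem lt_right_slope {a : ℝ} (ha : 0 < a) (N : ℝ) (hN : 1 / a ≤ N) :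
    ∃ s₀ > 0, ∀ s, 0 < s → s < s₀ → ∀ φ ψ, IsPositiveSolution a (rightPotential a s) φ ψ →
      0 ≤ ψ 0 → N * φ a < ψ a := by
  have hN0 : 0 < N := lt_of_lt_of_le (by positivity) hN
  refine ⟨3 * a / (2 * N) * Real.exp (-(3 * a * N)), by positivity, ?_⟩
  intro s hs hs0 φ ψ h hψ0
  by_contra hcon
  push Not at hcon
  have hls : Real.log s < Real.log (3 * a / (2 * N)) - 3 * a * N := by
    rw [Real.log_lt_iff_lt_exp hs, sub_eq_add_neg, Real.exp_add, Real.exp_log (by positivity)]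
    exact hs0
  have hv : ∀ z ∈ Icc 0 a, 0 < s + (2 * a * (a - z) + (a - z) ^ 2) := by
    intro z hz
    nlinarith [hz.1, hz.2, mul_nonneg ha.le (sub_nonneg.2 hz.2)]
  have hmono : MonotoneOn ψ (Icc 0 a) := by
    refine monotoneOn_of_hasDerivWithinAt_nonneg (convex_Icc _ _) h.continuousOn'
      (fun y hy => (h.deriv' y (interior_subset hy)).hasDerivWithinAt) fun y hy => ?_
    have h1 := hv y (interior_subset hy)
    have h2 := h.nonneg (interior_subset hy)
    unfold rightPotential
    positivity
  have hpa : 0 < φ a := h.pos a ⟨ha, le_rfl⟩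
  have haa : a ∈ Icc 0 a := ⟨ha.le, le_rfl⟩
  obtain ⟨z₁, hz₁⟩ : ∃ z₁, z₁ = a - 1 / (2 * N) := ⟨_, rfl⟩
  have h2N : 1 / (2 * N) ≤ a / 2 := by
    rw [div_le_iff₀ ha] at hN
    rw [div_le_div_iff₀ (by positivity) (by norm_num)]; nlinarith
  have h2N' : 0 < 1 / (2 * N) := by positivity
  have hz0 : 0 ≤ z₁ := by linarith
  have hsub : Icc z₁ a ⊆ Icc 0 a := Icc_subset_Icc_left hz0
  have hlow : ∀ z ∈ Icc z₁ a, φ a / 2 ≤ φ z := by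
    intro z hz
    have hanti : AntitoneOn (fun z => φ z - N * φ a * z) (Icc 0 a) := by
      refine antitoneOn_of_hasDerivWithinAt_nonpos (convex_Icc _ _)
        (h.continuousOn.sub (by fun_prop))
        (fun y hy => ((h.deriv y (interior_subset hy)).sub
          ((hasDerivAt_id y).const_mul (N * φ a))).hasDerivWithinAt) fun y hy => ?_
      have := hmono (interior_subset hy) haa (interior_subset hy).2
      linarith
    have h1 := hanti (hsub hz) haa hz.2
    simp only at h1
    have h3 : N * φ a * (a - z) ≤ N * φ a * (1 / (2 * N)) :=
      mul_le_mul_of_nonneg_left (by linarith [hz.1]) (by positivity)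
    have h4 : N * φ a * (1 / (2 * N)) = φ a / 2 := by field_simp
    linarith
  -- `2 / (s + 3 a (a - z))` bounds the potential from below and has an explicit primitive
  have hlogmono : MonotoneOn
      (fun z => ψ z + φ a / 2 * (2 / (3 * a) * Real.log (s + 3 * a * (a - z)))) (Icc z₁ a) := by
    have hder : ∀ z ∈ Icc z₁ a, HasDerivAt
        (fun z => ψ z + φ a / 2 * (2 / (3 * a) * Real.log (s + 3 * a * (a - z))))
        (rightPotential a s z * φ z
          + φ a / 2 * (2 / (3 * a) * ((3 * a * -1) / (s + 3 * a * (a - z))))) z := by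
      intro z hz
      have hl : 0 < s + 3 * a * (a - z) := by nlinarith [hz.2]
      have h2 : HasDerivAt (fun z => s + 3 * a * (a - z)) (3 * a * -1) z :=
        (((hasDerivAt_id z).const_sub a).const_mul (3 * a)).const_add s
      exact (h.deriv' z (hsub hz)).add (((h2.log hl.ne').const_mul _).const_mul _)
    refine monotoneOn_of_hasDerivWithinAt_nonneg (convex_Icc _ _)
      (fun y hy => (hder y hy).continuousAt.continuousWithinAt)
      (fun y hy => (hder y (interior_subset hy)).hasDerivWithinAt) fun y hy => ?_
    have hy' := interior_subset hy
    have hl : 0 < s + 3 * a * (a - y) := by nlinarith [hy'.2]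
    have e2 : 2 / (3 * a) * ((3 * a * -1) / (s + 3 * a * (a - y)))
        = -(2 / (s + 3 * a * (a - y))) := by
      field_simp
    have e3 : 2 / (s + 3 * a * (a - y)) ≤ rightPotential a s y := by
      have : 2 / (s + 3 * a * (a - y)) ≤ 2 / (s + (2 * a * (a - y) + (a - y) ^ 2)) := by
        refine div_le_div_of_nonneg_left (by norm_num) (hv y (hsub hy')) ?_
        nlinarith [hy'.2, (hsub hy').1]
      unfold rightPotential; linarith
    have e4 : 0 ≤ 2 / (s + 3 * a * (a - y)) := by positivity
    rw [e2]
    have := mul_le_mul e3 (hlow y hy') (by positivity) (e4.trans e3)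
    linarith
  have hfin := hlogmono ⟨le_rfl, by linarith⟩ ⟨by linarith, le_rfl⟩ (by linarith : z₁ ≤ a)
  have hψz : 0 ≤ ψ z₁ := hψ0.trans (hmono ⟨le_rfl, ha.le⟩ ⟨hz0, by linarith⟩ hz0)
  simp only at hfin
  have e1 : s + 3 * a * (a - a) = s := by ring
  have e2 : Real.log (3 * a / (2 * N)) ≤ Real.log (s + 3 * a * (a - z₁)) := by
    refine Real.log_le_log (by positivity) ?_
    rw [hz₁]
    have : 3 * a * (a - (a - 1 / (2 * N))) = 3 * a / (2 * N) := by field_simp; ring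
    rw [this]; linarith
  rw [e1] at hfin
  have e3 : φ a / 2 * (2 / (3 * a)) * (3 * a * N) = N * φ a := by field_simp
  have e4 : φ a / 2 * (2 / (3 * a)) * (3 * a * N)
      < φ a / 2 * (2 / (3 * a)) * (Real.log (s + 3 * a * (a - z₁)) - Real.log s) :=
    mul_lt_mul_of_pos_left (by linarith) (by positivity)
  linarith

/-! ### Matching across the gap -/

/-- The left solutions, continuous in the parameter `d`. They are built as `φ = u g` with
`u = Ψ₀' - lam`, which solves `u'' = V u`: the factor `g` satisfies `g' = p / u²`, `p' = u² g`, so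
it increases, and `φ` has larger logarithmic derivative than `u`. -/
theorem exists_left_family {a d₁ d₂ : ℝ} (ha : 0 < a) (hd₁ : 0 < d₁) (hd₂ : d₁ ≤ d₂) :
    ∃ φ ψ : ℝ → ℝ → ℝ, ContinuousOn (fun d => φ d a) (Icc d₁ d₂) ∧
      ContinuousOn (fun d => ψ d a) (Icc d₁ d₂) ∧
      ∀ d ∈ Icc d₁ d₂, IsPositiveSolution a (leftPotential a d) (φ d) (ψ d) ∧
        -(2 * a / d) * φ d a < ψ d a := by
  -- clamped so that the coefficients are bounded for all parameters and times
  let u : ℝ → ℝ → ℝ := fun d y => max d₁ (min (d₂ + a ^ 2) (d + (a ^ 2 - y ^ 2)))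
  have hu0 : ∀ d y, d₁ ≤ u d y := fun d y => le_max_left _ _
  have hupos : ∀ d y, 0 < u d y := fun d y => hd₁.trans_le (hu0 d y)
  have hu1 : ∀ d y, u d y ≤ d₂ + a ^ 2 := fun d y =>
    max_le (by nlinarith [sq_nonneg a]) (min_le_left _ _)
  have hueq : ∀ d ∈ Icc d₁ d₂, ∀ y ∈ Icc 0 a, u d y = d + (a ^ 2 - y ^ 2) := by
    intro d hd y hy
    have h1 : d₁ ≤ d + (a ^ 2 - y ^ 2) := by nlinarith [hd.1, hy.1, hy.2]
    have h2 : d + (a ^ 2 - y ^ 2) ≤ d₂ + a ^ 2 := by nlinarith [hd.2, sq_nonneg y]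
    simp only [u]
    rw [min_eq_right h2, max_eq_right h1]
  have huc : Continuous (Function.uncurry u) := by
    simp only [u, Function.uncurry_def]; fun_prop
  obtain ⟨g, p, hgc, hpc, hg0, hp0, hg, hp⟩ := exists_system_flow
    (fun d y => (u d y ^ 2)⁻¹) (fun d y => u d y ^ 2)
    (by
      have : Continuous fun q : ℝ × ℝ => (u q.1 q.2 ^ 2)⁻¹ :=
        (huc.pow 2).inv₀ fun x => pow_ne_zero 2 (hupos _ _).ne'
      exact this)
    (by
      have : Continuous fun q : ℝ × ℝ => u q.1 q.2 ^ 2 := huc.pow 2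
      exact this)
    (max (d₁ ^ 2)⁻¹ ((d₂ + a ^ 2) ^ 2))
    (fun d y => by
      rw [abs_of_nonneg (by positivity)]
      exact (inv_anti₀ (by positivity) (pow_le_pow_left₀ hd₁.le (hu0 d y) 2)).trans
        (le_max_left _ _))
    (fun d y => by
      rw [abs_of_nonneg (by positivity)]
      exact (pow_le_pow_left₀ (hupos d y).le (hu1 d y) 2).trans (le_max_right _ _))
  have hga : Continuous fun d => g d a := hgc.comp (Continuous.prodMk_left a)
  have hpa : Continuous fun d => p d a := hpc.comp (Continuous.prodMk_left a)
  refine ⟨fun d y => (d + (a ^ 2 - y ^ 2)) * g d y,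
    fun d y => -2 * y * g d y + p d y / (d + (a ^ 2 - y ^ 2)), ?_, ?_, fun d hd => ?_⟩
  · exact Continuous.continuousOn (by fun_prop)
  · refine ContinuousOn.add (Continuous.continuousOn (by fun_prop))
      (hpa.continuousOn.div (by fun_prop) fun d hd => ?_)
    have : 0 < d := hd₁.trans_le hd.1
    simpa using this.ne'
  · have hd0 : 0 < d := hd₁.trans_le hd.1
    have hsign := system_pos (ℓ := a) (fun y _ => by have := hupos d y; positivity)
      (fun y _ => by positivity) (hg0 d) (hp0 d) (fun y hy => hg d y hy.1)
      (fun y hy => hp d y hy.1)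
    have hw : ∀ y ∈ Icc 0 a, 0 < d + (a ^ 2 - y ^ 2) := fun y hy => by
      rw [← hueq d hd y hy]; exact hupos d y
    have hwd : ∀ y, HasDerivAt (fun y => d + (a ^ 2 - y ^ 2)) (-2 * y) y := fun y => by
      have := (((hasDerivAt_id y).pow 2).const_sub (a ^ 2)).const_add d
      refine this.congr_deriv ?_
      simp
    have hg' : ∀ y ∈ Icc 0 a, HasDerivAt (g d) (((d + (a ^ 2 - y ^ 2)) ^ 2)⁻¹ * p d y) y :=
      fun y hy => by rw [← hueq d hd y hy]; exact hg d y hy.1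
    have hp' : ∀ y ∈ Icc 0 a, HasDerivAt (p d) ((d + (a ^ 2 - y ^ 2)) ^ 2 * g d y) y :=
      fun y hy => by rw [← hueq d hd y hy]; exact hp d y hy.1
    refine ⟨⟨by simp [hg0], fun y hy => ?_, fun y hy => ?_, fun y hy => ?_⟩, ?_⟩
    · refine ((hwd y).mul (hg' y hy)).congr_deriv ?_
      have := (hw y hy).ne'
      field_simp
    · have h1 : HasDerivAt (fun y : ℝ => -2 * y) (-2) y := by
        simpa using (hasDerivAt_id y).const_mul (-2 : ℝ)
      refine ((h1.mul (hg' y hy)).add ((hp' y hy).div (hwd y) (hw y hy).ne')).congr_deriv ?_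
      have := (hw y hy).ne'
      unfold leftPotential
      field_simp
      ring
    · exact mul_pos (hw y ⟨hy.1.le, hy.2⟩) (hsign.2 y hy)
    · have h1 := hsign.1 a ⟨ha.le, le_rfl⟩
      have e : d + (a ^ 2 - a ^ 2) = d := by ring
      have h2 : -(2 * a / d) * (d * g d a) = -2 * a * g d a := by field_simp
      simp only [e]
      rw [h2]
      have : 0 < p d a / d := by positivity
      linarith

/-- The right solutions, continuous in the parameter `s`. -/
theorem exists_right_family {a s₁ : ℝ} (ha : 0 < a) (hs₁ : 0 < s₁) :
    ∃ φ ψ : ℝ → ℝ → ℝ, Continuous (fun s => φ s a) ∧ Continuous (fun s => ψ s a) ∧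
      ∀ s, s₁ ≤ s → IsPositiveSolution a (rightPotential a s) (φ s) (ψ s) ∧
        0 ≤ ψ s 0 ∧ 0 < ψ s a := by
  let v : ℝ → ℝ → ℝ := fun s z => max s₁ (s + (2 * a * (a - z) + (a - z) ^ 2))
  have hv0 : ∀ s z, s₁ ≤ v s z := fun s z => le_max_left _ _
  have hvpos : ∀ s z, 0 < v s z := fun s z => hs₁.trans_le (hv0 s z)
  have hveq : ∀ s, s₁ ≤ s → ∀ z ∈ Icc 0 a, v s z = s + (2 * a * (a - z) + (a - z) ^ 2) := by
    intro s hs z hz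
    have : 0 ≤ a - z := by linarith [hz.2]
    exact max_eq_right (by nlinarith [mul_nonneg ha.le this])
  have hvc : Continuous (Function.uncurry v) := by
    simp only [v, Function.uncurry_def]; fun_prop
  obtain ⟨g, p, hgc, hpc, hg0, hp0, hg, hp⟩ := exists_system_flow
    (fun _ _ => 1) (fun s z => 1 + 2 / v s z) continuous_const
    (by
      have : Continuous fun q : ℝ × ℝ => 1 + 2 / v q.1 q.2 :=
        continuous_const.add (continuous_const.div hvc fun x => (hvpos _ _).ne')
      exact this) (1 + 2 / s₁)
    (fun s z => by rw [abs_one]; have : 0 < 2 / s₁ := by positivity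
                   linarith)
    (fun s z => by
      have := hvpos s z
      rw [abs_of_nonneg (by positivity)]
      have := div_le_div_of_nonneg_left (by norm_num : (0 : ℝ) ≤ 2) hs₁ (hv0 s z)
      linarith)
  refine ⟨g, p, hgc.comp (Continuous.prodMk_left a), hpc.comp (Continuous.prodMk_left a),
    fun s hs => ?_⟩
  have hsign := system_pos (ℓ := a) (fun z _ => one_pos)
    (fun z _ => by have := hvpos s z; positivity) (hg0 s) (hp0 s) (fun y hy => hg s y hy.1)
    (fun y hy => hp s y hy.1)
  refine ⟨⟨hg0 s, fun y hy => by simpa using hg s y hy.1, fun y hy => ?_, hsign.2⟩, by simp [hp0],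
    hsign.1 a ⟨ha.le, le_rfl⟩⟩
  unfold rightPotential
  rw [← hveq s hs y hy]
  exact hp s y hy.1

theorem sinh_lt_mul_cosh {ε : ℝ} (hε : 0 < ε) : Real.sinh ε < ε * Real.cosh ε := by
  have hmono : StrictMonoOn (fun t => t * Real.cosh t - Real.sinh t) (Icc 0 ε) := by
    refine strictMonoOn_of_hasDerivWithinAt_pos (convex_Icc _ _) (by fun_prop)
      (fun t _ => (((hasDerivAt_id t).mul (Real.hasDerivAt_cosh t)).sub
        (Real.hasDerivAt_sinh t)).hasDerivWithinAt) fun t ht => ?_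
    rw [interior_Icc] at ht
    have := mul_pos ht.1 (Real.sinh_pos_iff.2 ht.1)
    simp only [id]; linarith
  have := hmono ⟨le_rfl, hε.le⟩ ⟨hε.le, le_rfl⟩ hε
  simp at this
  linarith

/-- For some parameter `s`, the left solution, continued through the gap by the equation `φ'' = φ`,
agrees at `b` with a positive multiple `c` of the right solution. The matching function is negative
for `s` near `2 a ε` and positive for `s` near `0`, the latter because `tanh ε < ε`. -/
theorem exists_matching {a ε : ℝ} (ha : 0 < a) (ha' : a < 1 / 2) (hε : 0 < ε) :
    ∃ s ∈ Ioo 0 (2 * a * ε), ∃ φ ψ χ θ : ℝ → ℝ, ∃ c > 0,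
      IsPositiveSolution a (leftPotential a (2 * a * ε - s)) φ ψ ∧
      IsPositiveSolution a (rightPotential a s) χ θ ∧
      φ a * Real.cosh ε + ψ a * Real.sinh ε = c * χ a ∧
      φ a * Real.sinh ε + ψ a * Real.cosh ε = -(c * θ a) := by
  obtain ⟨C, hC⟩ : ∃ C, C = Real.cosh ε := ⟨_, rfl⟩
  obtain ⟨S, hS⟩ : ∃ S, S = Real.sinh ε := ⟨_, rfl⟩
  have hC0 : 0 < C := hC ▸ Real.cosh_pos ε
  have hS0 : 0 < S := hS ▸ Real.sinh_pos_iff.2 hε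
  have hSC : S < C := hC ▸ hS ▸ Real.sinh_lt_cosh ε
  have hSεC : S < ε * C := hC ▸ hS ▸ sinh_lt_mul_cosh hε
  rw [← hC, ← hS]
  obtain ⟨D, hD⟩ : ∃ D, D = 2 * a * ε := ⟨_, rfl⟩
  have hD0 : 0 < D := by rw [hD]; positivity
  -- `S / ε < C` leaves the margin `κ` in `C + (B / A) S` when `B / A` is close to `-1 / ε`
  obtain ⟨κ, hκ⟩ : ∃ κ, κ = (C - S / ε) / 2 := ⟨_, rfl⟩
  have hκ0 : 0 < κ := by
    have : S / ε < C := by rw [div_lt_iff₀ hε]; linarith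
    rw [hκ]; linarith
  obtain ⟨d₀, hd₀, hleft⟩ := left_slope_lt ha ha' (C / S)
  obtain ⟨s₀, hs₀, hright⟩ := lt_right_slope ha (max (1 / a) (2 * C / (ε * κ))) (le_max_left _ _)
  -- parameters at which the matching function has opposite signs
  obtain ⟨s₁, hs₁, hs₁'⟩ : ∃ s₁, 0 < s₁ ∧ s₁ < min s₀ (min (D / 2) (a * (ε * C - S) / C)) :=
    exists_between (lt_min hs₀ (lt_min (by positivity)
      (div_pos (mul_pos ha (by linarith)) hC0)))
  obtain ⟨s₂, hs₂, hs₂'⟩ : ∃ s₂, max (D / 2) (D - d₀) < s₂ ∧ s₂ < D :=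
    exists_between (max_lt (by linarith) (by linarith))
  have h1D : s₁ < D / 2 := hs₁'.trans_le ((min_le_right _ _).trans (min_le_left _ _))
  have h2D : D / 2 < s₂ := (le_max_left _ _).trans_lt hs₂
  have h12 : s₁ ≤ s₂ := by linarith
  obtain ⟨φ, ψ, hφc, hψc, hφ⟩ := exists_left_family (d₁ := D - s₂) (d₂ := D - s₁) ha
    (by linarith) (by linarith)
  obtain ⟨χ, θ, hχc, hθc, hχ⟩ := exists_right_family ha hs₁
  have hmaps : MapsTo (fun s => D - s) (Icc s₁ s₂) (Icc (D - s₂) (D - s₁)) :=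
    fun s hs => ⟨by linarith [hs.2], by linarith [hs.1]⟩
  have hφc' : ContinuousOn (fun s => φ (D - s) a) (Icc s₁ s₂) :=
    hφc.comp (f := fun s => D - s) (by fun_prop) hmaps
  have hψc' : ContinuousOn (fun s => ψ (D - s) a) (Icc s₁ s₂) :=
    hψc.comp (f := fun s => D - s) (by fun_prop) hmaps
  have hFc : ContinuousOn (fun s =>
      (φ (D - s) a * C + ψ (D - s) a * S) * θ s a
        + (φ (D - s) a * S + ψ (D - s) a * C) * χ s a) (Icc s₁ s₂) := by
    fun_prop
  have hF1 : 0 < (φ (D - s₁) a * C + ψ (D - s₁) a * S) * θ s₁ a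
        + (φ (D - s₁) a * S + ψ (D - s₁) a * C) * χ s₁ a := by
    obtain ⟨hL, hLs⟩ := hφ (D - s₁) (hmaps ⟨le_rfl, h12⟩)
    obtain ⟨hR, hR0, hRa⟩ := hχ s₁ le_rfl
    have hA := hL.pos a ⟨ha, le_rfl⟩
    have hX := hR.pos a ⟨ha, le_rfl⟩
    have hR1 := hright s₁ hs₁ (hs₁'.trans_le (min_le_left _ _)) _ _ hR hR0
    have hd : 0 < D - s₁ := by linarith
    have k1 : S * (2 * a / (D - s₁)) ≤ C - κ := by
      have h3 : s₁ * C < a * (ε * C - S) := by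
        rw [← lt_div_iff₀ hC0]
        exact hs₁'.trans_le ((min_le_right _ _).trans (min_le_right _ _))
      have e : (C - κ) * D = a * (ε * C + S) := by
        rw [hκ, hD]; field_simp; ring
      rw [← mul_div_assoc, div_le_iff₀ hd]
      nlinarith [mul_pos hκ0 hs₁]
    have k2 : 2 * a / (D - s₁) ≤ 2 / ε := by
      rw [div_le_div_iff₀ hd hε]
      linarith
    have k3 : κ * φ (D - s₁) a ≤ φ (D - s₁) a * C + ψ (D - s₁) a * S := by
      have := mul_le_mul_of_nonneg_right k1 hA.le
      have := mul_le_mul_of_nonneg_right hLs.le hS0.le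
      linarith
    have k4 : -(2 / ε * C) * φ (D - s₁) a ≤ φ (D - s₁) a * S + ψ (D - s₁) a * C := by
      have e1 := mul_le_mul_of_nonneg_right k2 (mul_pos hA hC0).le
      have e2 := mul_le_mul_of_nonneg_right hLs.le hC0.le
      have e3 := mul_pos hA hS0
      linarith
    have k5 : 2 * C / (ε * κ) * χ s₁ a < θ s₁ a :=
      (mul_le_mul_of_nonneg_right (le_max_right _ _) hX.le).trans_lt hR1
    have k6 : κ * φ (D - s₁) a * (2 * C / (ε * κ) * χ s₁ a) < κ * φ (D - s₁) a * θ s₁ a :=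
      mul_lt_mul_of_pos_left k5 (by positivity)
    have k7 : κ * φ (D - s₁) a * (2 * C / (ε * κ) * χ s₁ a)
        = 2 / ε * C * φ (D - s₁) a * χ s₁ a := by field_simp
    have k8 := mul_le_mul_of_nonneg_right k3 hRa.le
    have k9 := mul_le_mul_of_nonneg_right k4 hX.le
    linarith
  have hF2 : (φ (D - s₂) a * C + ψ (D - s₂) a * S) * θ s₂ a
        + (φ (D - s₂) a * S + ψ (D - s₂) a * C) * χ s₂ a < 0 := by
    obtain ⟨hL, -⟩ := hφ (D - s₂) (hmaps ⟨h12, le_rfl⟩)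
    obtain ⟨hR, hR0, hRa⟩ := hχ s₂ h12
    have hA := hL.pos a ⟨ha, le_rfl⟩
    have hX := hR.pos a ⟨ha, le_rfl⟩
    have hl := hleft (D - s₂) (by linarith) (by linarith [(le_max_right _ _).trans_lt hs₂]) _ _ hL
    have k0 : ψ (D - s₂) a * S < -(C * φ (D - s₂) a) := by
      have := mul_lt_mul_of_pos_right hl hS0
      have e : -(C / S) * φ (D - s₂) a * S = -(C * φ (D - s₂) a) := by field_simp
      linarith
    have k1 : φ (D - s₂) a * C + ψ (D - s₂) a * S < 0 := by linarith
    have k2 : φ (D - s₂) a * S + ψ (D - s₂) a * C < 0 := by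
      have : ψ (D - s₂) a < 0 := by
        by_contra hc
        push Not at hc
        have := mul_nonneg hc hS0.le
        have := mul_pos hC0 hA
        linarith
      nlinarith
    have := mul_neg_of_neg_of_pos k1 hRa
    have := mul_neg_of_neg_of_pos k2 hX
    linarith
  obtain ⟨s, hs, hs0⟩ := intermediate_value_Icc' h12 hFc ⟨hF2.le, hF1.le⟩
  simp only at hs0
  obtain ⟨hL, -⟩ := hφ (D - s) (hmaps hs)
  obtain ⟨hR, hR0, hRa⟩ := hχ s hs.1
  have hA := hL.pos a ⟨ha, le_rfl⟩
  have hX := hR.pos a ⟨ha, le_rfl⟩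
  -- at a zero of the matching function the continued solution is positive at `b`
  have hval : 0 < φ (D - s) a * C + ψ (D - s) a * S := by
    by_contra hc
    push Not at hc
    have k1 : (φ (D - s) a * S + ψ (D - s) a * C) < 0 := by
      have e : (φ (D - s) a * S + ψ (D - s) a * C) * S
          = C * (φ (D - s) a * C + ψ (D - s) a * S) - φ (D - s) a * (C ^ 2 - S ^ 2) := by ring
      have : (φ (D - s) a * S + ψ (D - s) a * C) * S < 0 := by
        rw [e]
        have h1 := mul_nonneg hC0.le (neg_nonneg.2 hc)
        have h2 : 0 < φ (D - s) a * (C ^ 2 - S ^ 2) := mul_pos hA (by nlinarith)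
        linarith
      by_contra hc'
      push Not at hc'
      nlinarith [mul_nonneg hc' hS0.le]
    have h1 := mul_neg_of_neg_of_pos k1 hX
    have h2 := mul_nonneg (neg_nonneg.2 hc) hRa.le
    linarith
  refine ⟨s, ⟨by linarith [hs.1], by linarith [hs.2]⟩, φ (D - s), ψ (D - s), χ s, θ s,
    (φ (D - s) a * C + ψ (D - s) a * S) / χ s a, div_pos hval hX, ?_, hR, ?_, ?_⟩
  · rw [← hD]; exact hL
  · field_simp
  · field_simp
    linarith

/-! ### The ground state -/

open Classical in
/-- The potential `V`: it is `2 / (lam - Ψ₀')` where `ϖ' = -2`, and `0` in the gap (and outside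
`[0, 1]`). -/
noncomputable def rayleighPotential (ε lam y : ℝ) : ℝ :=
  if y ∈ dom ε then 2 / (lam - Psi0Deriv ε y) else 0

/-- `φ` is a positive solution of `φ'' = (1 + V) φ` on `(0, 1)` with Dirichlet conditions, and `ψ` is
its derivative. The equation holds off the two jumps of `V`; `φ` is `C¹` across them. Part of the
notion is that `lam - Ψ₀'` has no zeros outside the open gap. -/
structure IsGroundState (ε lam : ℝ) (φ ψ : ℝ → ℝ) : Prop where
  ne : ∀ y ∈ closedDom ε, lam - Psi0Deriv ε y ≠ 0
  zero : φ 0 = 0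
  one : φ 1 = 0
  deriv : ∀ y ∈ Icc (0 : ℝ) 1, HasDerivAt φ (ψ y) y
  cont : ContinuousOn ψ (Icc 0 1)
  deriv' : ∀ y ∈ Ioo (0 : ℝ) 1, y ≠ aEps ε → y ≠ bEps ε →
    HasDerivAt ψ ((1 + rayleighPotential ε lam y) * φ y) y
  pos : ∀ y ∈ Ioo (0 : ℝ) 1, 0 < φ y
  smooth : ContDiffOn ℝ ∞ φ (closedDom ε)

theorem hasDerivAt_ite_le {f₁ f₂ : ℝ → ℝ} {c d y : ℝ} (h₁ : y ≤ c → HasDerivAt f₁ d y)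
    (h₂ : c ≤ y → HasDerivAt f₂ d y) (h : y = c → f₁ y = f₂ y) :
    HasDerivAt (fun y => if y ≤ c then f₁ y else f₂ y) d y := by
  rcases lt_trichotomy y c with hy | hy | hy
  · refine (h₁ hy.le).congr_of_eventuallyEq ?_
    filter_upwards [Iio_mem_nhds hy] with z hz
    rw [if_pos (le_of_lt hz)]
  · have h3 : HasDerivWithinAt (fun y => if y ≤ c then f₁ y else f₂ y) d (Iic c) y :=
      (h₁ hy.le).hasDerivWithinAt.congr (fun z hz => if_pos hz) (if_pos hy.le)
    have h4 : HasDerivWithinAt (fun y => if y ≤ c then f₁ y else f₂ y) d (Ioi c) y :=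
      (h₂ hy.ge).hasDerivWithinAt.congr (fun z hz => if_neg (not_le.2 hz))
        ((if_pos hy.le).trans (h hy))
    have := h3.union h4
    rwa [Iic_union_Ioi, hasDerivWithinAt_univ] at this
  · refine (h₂ hy.le).congr_of_eventuallyEq ?_
    filter_upwards [Ioi_mem_nhds hy] with z hz
    rw [if_neg (not_le.2 hz)]

theorem continuousAt_ite_le {f₁ f₂ : ℝ → ℝ} {c y : ℝ} (h₁ : y ≤ c → ContinuousAt f₁ y)
    (h₂ : c ≤ y → ContinuousAt f₂ y) (h : y = c → f₁ y = f₂ y) :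
    ContinuousAt (fun y => if y ≤ c then f₁ y else f₂ y) y := by
  rcases lt_trichotomy y c with hy | hy | hy
  · refine (h₁ hy.le).congr ?_
    filter_upwards [Iio_mem_nhds hy] with z hz
    rw [if_pos (le_of_lt hz)]
  · have h3 : ContinuousWithinAt (fun y => if y ≤ c then f₁ y else f₂ y) (Iic c) y :=
      (h₁ hy.le).continuousWithinAt.congr (fun z hz => if_pos hz) (if_pos hy.le)
    have h4 : ContinuousWithinAt (fun y => if y ≤ c then f₁ y else f₂ y) (Ioi c) y :=
      (h₂ hy.ge).continuousWithinAt.congr (fun z hz => if_neg (not_le.2 hz))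
        ((if_pos hy.le).trans (h hy))
    have := h3.union h4
    rwa [Iic_union_Ioi, continuousWithinAt_univ] at this
  · refine (h₂ hy.le).congr ?_
    filter_upwards [Ioi_mem_nhds hy] with z hz
    rw [if_neg (not_le.2 hz)]

theorem IsPositiveSolution.contDiffOn {ℓ : ℝ} {q φ ψ : ℝ → ℝ} (hℓ : 0 < ℓ)
    (h : IsPositiveSolution ℓ q φ ψ) (hq : ContDiffOn ℝ ∞ q (Icc 0 ℓ)) :
    ContDiffOn ℝ ∞ φ (Icc 0 ℓ) := by
  have hu : UniqueDiffOn ℝ (Icc 0 ℓ) := uniqueDiffOn_Icc hℓ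
  suffices ∀ n : ℕ, ContDiffOn ℝ n φ (Icc 0 ℓ) ∧ ContDiffOn ℝ n ψ (Icc 0 ℓ) from
    contDiffOn_infty.2 fun n => (this n).1
  intro n
  induction n with
  | zero => exact ⟨contDiffOn_zero.2 h.continuousOn, contDiffOn_zero.2 h.continuousOn'⟩
  | succ n ih =>
    have hqn : ContDiffOn ℝ n q (Icc 0 ℓ) := contDiffOn_infty.1 hq n
    constructor
    · push_cast
      rw [contDiffOn_succ_iff_derivWithin hu]
      refine ⟨fun y hy => (h.deriv y hy).differentiableAt.differentiableWithinAt, by simp,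
        ih.2.congr fun y hy => (h.deriv y hy).hasDerivWithinAt.derivWithin (hu y hy)⟩
    · push_cast
      rw [contDiffOn_succ_iff_derivWithin hu]
      refine ⟨fun y hy => (h.deriv' y hy).differentiableAt.differentiableWithinAt, by simp,
        (hqn.mul ih.1).congr fun y hy => (h.deriv' y hy).hasDerivWithinAt.derivWithin (hu y hy)⟩

/-- Smoothness may be checked on the two components separately, as they are at positive distance. -/
theorem contDiffOn_closedDom {ε : ℝ} (h0 : 0 < ε) {f : ℝ → ℝ}
    (hl : ContDiffOn ℝ ∞ f (Icc 0 (aEps ε))) (hr : ContDiffOn ℝ ∞ f (Icc (bEps ε) 1)) :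
    ContDiffOn ℝ ∞ f (closedDom ε) := by
  have hab : aEps ε < bEps ε := by unfold aEps bEps; linarith
  have hab2 : aEps ε < 1 / 2 := by unfold aEps; linarith
  have hab3 : 1 / 2 < bEps ε := by unfold bEps; linarith
  rintro y (hy | hy)
  · refine ((hl y hy).mono_of_mem_nhdsWithin ?_)
    filter_upwards [self_mem_nhdsWithin, mem_nhdsWithin_of_mem_nhds
      (Iio_mem_nhds (hy.2.trans_lt hab))] with z hz hz'
    rcases hz with hz | hz
    · exact hz
    · exact absurd hz.1 (not_le.2 hz')
  · refine ((hr y hy).mono_of_mem_nhdsWithin ?_)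
    filter_upwards [self_mem_nhdsWithin, mem_nhdsWithin_of_mem_nhds
      (Ioi_mem_nhds (hab.trans_le hy.1))] with z hz hz'
    rcases hz with hz | hz
    · exact absurd hz.2 (not_le.2 hz')
    · exact hz

/-- For every `0 < ε < 1` some `lam` admits a ground state: the left solution, its continuation
through the gap, and the reflected right solution, glued together. -/
theorem exists_groundState {ε : ℝ} (h0 : 0 < ε) (h1 : ε < 1) :
    ∃ lam : ℝ, ∃ φ ψ : ℝ → ℝ, IsGroundState ε lam φ ψ := by
  obtain ⟨a, ha⟩ : ∃ a, a = aEps ε := ⟨_, rfl⟩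
  obtain ⟨b, hb⟩ : ∃ b, b = bEps ε := ⟨_, rfl⟩
  have ha0 : 0 < a := by rw [ha]; unfold aEps; linarith
  have ha2 : a < 1 / 2 := by rw [ha]; unfold aEps; linarith
  have hba : b = a + ε := by rw [ha, hb]; unfold aEps bEps; ring
  have hb1 : 1 - b = a := by rw [ha, hb]; unfold aEps bEps; ring
  obtain ⟨s, hs, φ, ψ, χ, θ, c, hc, hL, hR, hm, hm'⟩ := exists_matching ha0 ha2 h0
  have hPl : ∀ y ∈ Icc 0 a, Psi0Deriv ε b + s - Psi0Deriv ε y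
      = -((2 * a * ε - s) + (a ^ 2 - y ^ 2)) := by
    intro y hy
    have e1 := Psi0Deriv_gap h0 h1
    have e2 := Psi0Deriv_left h0 h1 (y := y) (ha ▸ hy)
    rw [← ha] at e1 e2
    rw [← hb] at e1
    linarith
  have hPr : ∀ y ∈ Icc b 1, Psi0Deriv ε b + s - Psi0Deriv ε y
      = s + (2 * a * (a - (1 - y)) + (a - (1 - y)) ^ 2) := by
    intro y hy
    have e2 := Psi0Deriv_right h0 h1 (y := y) (hb ▸ hy)
    rw [← ha, ← hb] at e2
    have : a - (1 - y) = y - b := by linarith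
    rw [this]; linarith
  have hul : ∀ y ∈ Icc 0 a, 0 < (2 * a * ε - s) + (a ^ 2 - y ^ 2) := fun y hy => by
    nlinarith [hy.1, hy.2, hs.2]
  have hur : ∀ z ∈ Icc 0 a, 0 < s + (2 * a * (a - z) + (a - z) ^ 2) := fun z hz => by
    have := mul_nonneg ha0.le (sub_nonneg.2 hz.2)
    nlinarith [hs.1]
  have hrefl : ∀ y ∈ Icc b 1, 1 - y ∈ Icc 0 a := fun y hy =>
    ⟨by linarith [hy.2], by linarith [hy.1]⟩
  let γ : ℝ → ℝ := fun y => φ a * Real.cosh (y - a) + ψ a * Real.sinh (y - a)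
  let γ' : ℝ → ℝ := fun y => φ a * Real.sinh (y - a) + ψ a * Real.cosh (y - a)
  have hγ : ∀ y, HasDerivAt γ (γ' y) y := fun y => by
    have h := ((((hasDerivAt_id y).sub_const a).cosh).const_mul (φ a)).add
      ((((hasDerivAt_id y).sub_const a).sinh).const_mul (ψ a))
    exact h.congr_deriv (by simp [γ'])
  have hγ' : ∀ y, HasDerivAt γ' (γ y) y := fun y => by
    have h := ((((hasDerivAt_id y).sub_const a).sinh).const_mul (φ a)).add
      ((((hasDerivAt_id y).sub_const a).cosh).const_mul (ψ a))
    exact h.congr_deriv (by simp [γ])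
  have hχ : ∀ y ∈ Icc b 1, HasDerivAt (fun y => c * χ (1 - y)) (-(c * θ (1 - y))) y := by
    intro y hy
    have h := ((hR.deriv _ (hrefl y hy)).comp y ((hasDerivAt_id y).const_sub 1)).const_mul c
    refine h.congr_deriv (by simp)
  have hθ : ∀ y ∈ Icc b 1, HasDerivAt (fun y => -(c * θ (1 - y)))
      (rightPotential a s (1 - y) * (c * χ (1 - y))) y := by
    intro y hy
    have h := (((hR.deriv' _ (hrefl y hy)).comp y ((hasDerivAt_id y).const_sub 1)).const_mul c).neg
    refine h.congr_deriv (by ring)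
  have hγa : γ a = φ a := by simp [γ]
  have hγa' : γ' a = ψ a := by simp [γ']
  have hbaε : b - a = ε := by linarith
  have hγb : γ b = c * χ (1 - b) := by simp only [γ, hbaε, hb1]; exact hm
  have hγb' : γ' b = -(c * θ (1 - b)) := by simp only [γ', hbaε, hb1]; exact hm'
  have hγpos : ∀ y ∈ Icc a b, 0 < γ y := by
    intro y hy
    have hAp := hL.pos a ⟨ha0, le_rfl⟩
    have hBp : 0 < φ a * Real.cosh ε + ψ a * Real.sinh ε := by
      rw [hm]; exact mul_pos hc (hR.pos a ⟨ha0, le_rfl⟩)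
    have hS : 0 < Real.sinh ε := Real.sinh_pos_iff.2 h0
    -- in the gap the solution interpolates its positive values at `a` and `b`
    have e : γ y * Real.sinh ε = φ a * Real.sinh (ε - (y - a))
        + (φ a * Real.cosh ε + ψ a * Real.sinh ε) * Real.sinh (y - a) := by
      rw [Real.sinh_sub]; simp only [γ]; ring
    have : 0 < γ y * Real.sinh ε := by
      rw [e]
      rcases hy.1.eq_or_lt with h | h
      · have : y - a = 0 := by linarith
        rw [this]; simp; positivity
      · have h2 := mul_pos hBp (Real.sinh_pos_iff.2 (sub_pos.2 h))
        have h3 := mul_nonneg hAp.le (Real.sinh_nonneg_iff.2 (by linarith [hy.2] : 0 ≤ ε - (y - a)))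
        linarith
    exact pos_of_mul_pos_left this hS.le
  let Φ : ℝ → ℝ := fun y => if y ≤ a then φ y else (fun y => if y ≤ b then γ y else c * χ (1 - y)) y
  let Ψ : ℝ → ℝ := fun y => if y ≤ a then ψ y else
    (fun y => if y ≤ b then γ' y else -(c * θ (1 - y))) y
  have hab : a < b := by linarith
  have hΦl : ∀ y, y ≤ a → Φ y = φ y := fun y hy => if_pos hy
  have hΦr : ∀ y, b ≤ y → Φ y = c * χ (1 - y) := by
    intro y hy
    simp only [Φ]
    rw [if_neg (by linarith)]
    split_ifs with h
    · have : y = b := le_antisymm h hy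
      rw [this, hγb]
    · rfl
  have hΦg : ∀ y, a < y → y ≤ b → Φ y = γ y := by
    intro y hy hy'
    simp only [Φ]; rw [if_neg (by linarith), if_pos hy']
  have hΨl : ∀ y, y ≤ a → Ψ y = ψ y := fun y hy => if_pos hy
  have hΨr : ∀ y, b ≤ y → Ψ y = -(c * θ (1 - y)) := by
    intro y hy
    simp only [Ψ]
    rw [if_neg (by linarith)]
    split_ifs with h
    · have : y = b := le_antisymm h hy
      rw [this, hγb']
    · rfl
  have hΨg : ∀ y, a ≤ y → y ≤ b → Ψ y = γ' y := by
    intro y hy hy'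
    simp only [Ψ]
    split_ifs with h
    · have : y = a := le_antisymm h hy
      rw [this, hγa']
    · rfl
  refine ⟨Psi0Deriv ε b + s, Φ, Ψ, ?_⟩
  constructor
  · rintro y (hy | hy)
    · rw [← ha] at hy
      rw [hPl y hy]; exact (neg_neg_of_pos (hul y hy)).ne
    · rw [← hb] at hy
      rw [hPr y hy]; exact (hur _ (hrefl y hy)).ne'
  · rw [hΦl 0 ha0.le, hL.zero]
  · rw [hΦr 1 (by linarith)]; simp [hR.zero]
  · intro y hy
    refine hasDerivAt_ite_le (fun h => ?_) (fun h => ?_) (fun h => ?_)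
    · rw [hΨl y h]; exact hL.deriv y ⟨hy.1, h⟩
    · refine hasDerivAt_ite_le (fun h' => ?_) (fun h' => ?_) (fun h' => ?_)
      · rw [hΨg y h h']; exact hγ y
      · rw [hΨr y h']; exact hχ y ⟨h', hy.2⟩
      · rw [h', hγb]
    · rw [h, if_pos hab.le, hγa]
  · intro y hy
    refine ContinuousAt.continuousWithinAt ?_
    refine continuousAt_ite_le (fun h => ?_) (fun h => ?_) (fun h => ?_)
    · exact (hL.deriv' y ⟨hy.1, h⟩).continuousAt
    · refine continuousAt_ite_le (fun h' => ?_) (fun h' => ?_) (fun h' => ?_)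
      · exact (hγ' y).continuousAt
      · exact (hθ y ⟨h', hy.2⟩).continuousAt
      · rw [h', hγb']
    · rw [h, if_pos hab.le, hγa']
  · intro y hy hya hyb
    rw [← ha] at hya
    rw [← hb] at hyb
    rcases lt_or_gt_of_ne hya with h | h
    · have hV : 1 + rayleighPotential ε (Psi0Deriv ε b + s) y
          = leftPotential a (2 * a * ε - s) y := by
        unfold rayleighPotential leftPotential
        rw [if_pos ⟨⟨hy.1.le, hy.2.le⟩, Or.inl (ha ▸ h)⟩, hPl y ⟨hy.1.le, h.le⟩, div_neg]
        ring
      rw [hV, hΦl y h.le]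
      refine (hL.deriv' y ⟨hy.1.le, h.le⟩).congr_of_eventuallyEq ?_
      filter_upwards [Iio_mem_nhds h] with z hz
      exact hΨl z (le_of_lt hz)
    · rcases lt_or_gt_of_ne hyb with h' | h'
      · have hV : rayleighPotential ε (Psi0Deriv ε b + s) y = 0 := by
          unfold rayleighPotential
          rw [if_neg]
          rintro ⟨-, k | k⟩
          · rw [← ha] at k; linarith
          · rw [← hb] at k; linarith
        rw [hV, hΦg y h h'.le, add_zero, one_mul]
        refine (hγ' y).congr_of_eventuallyEq ?_
        filter_upwards [Ioo_mem_nhds h h'] with z hz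
        exact hΨg z hz.1.le hz.2.le
      · have hV : 1 + rayleighPotential ε (Psi0Deriv ε b + s) y
            = rightPotential a s (1 - y) := by
          unfold rayleighPotential rightPotential
          rw [if_pos ⟨⟨hy.1.le, hy.2.le⟩, Or.inr (hb ▸ h')⟩, hPr y ⟨h'.le, hy.2.le⟩]
        rw [hV, hΦr y h'.le]
        refine (hθ y ⟨h'.le, hy.2.le⟩).congr_of_eventuallyEq ?_
        filter_upwards [Ioi_mem_nhds h'] with z hz
        exact hΨr z (le_of_lt hz)
  · intro y hy
    rcases le_or_gt y a with h | h
    · rw [hΦl y h]; exact hL.pos y ⟨hy.1, h⟩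
    · rcases le_or_gt y b with h' | h'
      · rw [hΦg y h h']; exact hγpos y ⟨h.le, h'⟩
      · rw [hΦr y h'.le]
        exact mul_pos hc (hR.pos _ ⟨by linarith [hy.2], (hrefl y ⟨h'.le, hy.2.le⟩).2⟩)
  · refine contDiffOn_closedDom h0 ?_ ?_
    · rw [← ha]
      refine (hL.contDiffOn ha0 ?_).congr fun y hy => hΦl y hy.2
      unfold leftPotential
      exact contDiffOn_const.sub (contDiffOn_const.div (by fun_prop) fun y hy => (hul y hy).ne')
    · rw [← hb]
      have hχs : ContDiffOn ℝ ∞ χ (Icc 0 a) := by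
        refine hR.contDiffOn ha0 ?_
        unfold rightPotential
        exact contDiffOn_const.add (contDiffOn_const.div (by fun_prop) fun y hy => (hur y hy).ne')
      have hcomp : ContDiffOn ℝ ∞ (fun y => χ (1 - y)) (Icc b 1) :=
        hχs.comp (g := χ) (f := fun y => 1 - y) (by fun_prop) hrefl
      exact (contDiffOn_const.mul hcomp).congr fun y hy => hΦr y hy.1

/-! ### The Picone inequality -/

theorem continuous_Psi0Deriv (ε : ℝ) : Continuous (Psi0Deriv ε) := by
  have h1 : Continuous (profile ε) :=
    intervalIntegral.continuous_primitive (fun _ _ => intervalIntegrable_profileDeriv ε _ _) 0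
  have h2 : Continuous fun y => ∫ z in (0 : ℝ)..y, profile ε z :=
    intervalIntegral.continuous_primitive (fun _ _ => h1.intervalIntegrable _ _) 0
  unfold Psi0Deriv
  fun_prop

theorem measurable_rayleighPotential (ε lam : ℝ) : Measurable (rayleighPotential ε lam) := by
  classical
  unfold rayleighPotential
  exact Measurable.ite (measurableSet_dom ε)
    (measurable_const.div (measurable_const.sub (continuous_Psi0Deriv ε).measurable))
    measurable_const

theorem dom_subset_closedDom (ε : ℝ) : dom ε ⊆ closedDom ε := by
  rintro y ⟨hy, h | h⟩
  · exact Or.inl ⟨hy.1, h.le⟩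
  · exact Or.inr ⟨h.le, hy.2⟩

theorem exists_abs_rayleighPotential_le {ε lam : ℝ}
    (hne : ∀ y ∈ closedDom ε, lam - Psi0Deriv ε y ≠ 0) :
    ∃ B, 0 ≤ B ∧ ∀ y, |rayleighPotential ε lam y| ≤ B := by
  have hK : IsCompact (closedDom ε) := isCompact_Icc.union isCompact_Icc
  have hc : ContinuousOn (fun y => 2 / (lam - Psi0Deriv ε y)) (closedDom ε) :=
    continuousOn_const.div (continuous_const.sub (continuous_Psi0Deriv ε)).continuousOn hne
  obtain ⟨B, hB⟩ := hK.exists_bound_of_continuousOn hc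
  refine ⟨max B 0, le_max_right _ _, fun y => ?_⟩
  unfold rayleighPotential
  split_ifs with h
  · exact (hB y (dom_subset_closedDom ε h)).trans (le_max_left _ _)
  · simp

theorem intervalIntegrable_mul_of_bounded {w f : ℝ → ℝ} {B : ℝ} (hw : Measurable w)
    (hB : ∀ y, |w y| ≤ B) (hf : ContinuousOn f (Icc 0 1)) :
    IntervalIntegrable (fun y => w y * f y) volume 0 1 := by
  have h1 : IntervalIntegrable f volume 0 1 :=
    ContinuousOn.intervalIntegrable (by rwa [uIcc_of_le zero_le_one])
  rw [intervalIntegrable_iff] at h1 ⊢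
  exact h1.bdd_mul (c := B) hw.aestronglyMeasurable (ae_of_all _ hB)

/-- `g` is a `C¹` function on `[0, 1]` with derivative `g'` and `g(0) = g(1) = 0`. -/
structure IsTestFunction (g g' : ℝ → ℝ) : Prop where
  deriv : ∀ y ∈ Icc (0 : ℝ) 1, HasDerivWithinAt g (g' y) (Icc 0 1) y
  cont : ContinuousOn g' (Icc 0 1)
  zero : g 0 = 0
  one : g 1 = 0

theorem IsTestFunction.continuousOn {g g' : ℝ → ℝ} (h : IsTestFunction g g') :
    ContinuousOn g (Icc 0 1) := fun y hy => (h.deriv y hy).continuousWithinAt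

theorem IsGroundState.isTestFunction {ε lam : ℝ} {φ ψ : ℝ → ℝ} (h : IsGroundState ε lam φ ψ) :
    IsTestFunction φ ψ :=
  ⟨fun y hy => (h.deriv y hy).hasDerivWithinAt, h.cont, h.zero, h.one⟩

theorem IsGroundState.nonneg {ε lam : ℝ} {φ ψ : ℝ → ℝ} (h : IsGroundState ε lam φ ψ) {y : ℝ}
    (hy : y ∈ Icc (0 : ℝ) 1) : 0 ≤ φ y := by
  rcases hy.1.eq_or_lt with h0 | h0
  · rw [← h0, h.zero]
  rcases hy.2.eq_or_lt with h1 | h1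
  · rw [h1, h.one]
  exact (h.pos y ⟨h0, h1⟩).le

/-- The weak form of `φ'' = (1 + V) φ`. -/
theorem IsGroundState.weak {ε lam : ℝ} {φ ψ η η' : ℝ → ℝ} (h : IsGroundState ε lam φ ψ)
    (hη : IsTestFunction η η') :
    ∫ y in (0 : ℝ)..1, ψ y * η' y
      = -∫ y in (0 : ℝ)..1, (1 + rayleighPotential ε lam y) * (φ y * η y) := by
  obtain ⟨B, hB0, hB⟩ := exists_abs_rayleighPotential_le h.ne
  have hi1 : IntervalIntegrable (fun y => ψ y * η' y) volume 0 1 :=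
    ContinuousOn.intervalIntegrable (by rw [uIcc_of_le zero_le_one]; exact h.cont.mul hη.cont)
  have hi2 : IntervalIntegrable
      (fun y => (1 + rayleighPotential ε lam y) * (φ y * η y)) volume 0 1 :=
    intervalIntegrable_mul_of_bounded (B := 1 + B)
      (measurable_const.add (measurable_rayleighPotential ε lam))
      (fun y => (abs_add_le _ _).trans (by rw [abs_one]; linarith [hB y]))
      (h.isTestFunction.continuousOn.mul hη.continuousOn)
  have key := integral_eq_of_hasDerivAt_off_countable_of_le (fun y => ψ y * η y)
    (fun y => (1 + rayleighPotential ε lam y) * (φ y * η y) + ψ y * η' y) zero_le_one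
    (s := {aEps ε, bEps ε}) ((finite_singleton _).insert _).countable
    (h.cont.mul hη.continuousOn) ?_ (hi2.add hi1)
  · rw [intervalIntegral.integral_add hi2 hi1] at key
    simp only [hη.zero, hη.one] at key
    linarith
  · rintro y ⟨hy, hy'⟩
    simp only [mem_insert_iff, mem_singleton_iff, not_or] at hy'
    refine ((h.deriv' y hy hy'.1 hy'.2).mul ((hη.deriv y ⟨hy.1.le, hy.2.le⟩).hasDerivAt
      (Icc_mem_nhds hy.1 hy.2))).congr_deriv ?_
    ring

/-- Picone's identity, regularized by `δ`: it is the weak form tested with `g² / (φ + δ)`, which,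
unlike `g² / φ`, is plainly `C¹` up to the endpoints. -/
theorem IsGroundState.picone {ε lam : ℝ} {φ ψ g g' : ℝ → ℝ} (h : IsGroundState ε lam φ ψ)
    (hg : IsTestFunction g g') {δ : ℝ} (hδ : 0 < δ) :
    ∫ y in (0 : ℝ)..1, (g' y - g y * ψ y / (φ y + δ)) ^ 2
      = (∫ y in (0 : ℝ)..1, g' y ^ 2)
        + ∫ y in (0 : ℝ)..1, (1 + rayleighPotential ε lam y) * (φ y * (g y ^ 2 / (φ y + δ))) := by
  have hpos : ∀ y ∈ Icc (0 : ℝ) 1, φ y + δ ≠ 0 := fun y hy => by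
    have := h.nonneg hy; positivity
  have hφc := h.isTestFunction.continuousOn
  have hgc := hg.continuousOn
  have hg'c := hg.cont
  have hψc := h.cont
  have hη' : ContinuousOn (fun y => 2 * g y * g' y / (φ y + δ) - g y ^ 2 * ψ y / (φ y + δ) ^ 2)
      (Icc 0 1) := by
    refine ContinuousOn.sub (ContinuousOn.div (by fun_prop) (by fun_prop) hpos)
      (ContinuousOn.div (by fun_prop) (by fun_prop) fun y hy => pow_ne_zero 2 (hpos y hy))
  have hη : IsTestFunction (fun y => g y ^ 2 / (φ y + δ))
      (fun y => 2 * g y * g' y / (φ y + δ) - g y ^ 2 * ψ y / (φ y + δ) ^ 2) := by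
    refine ⟨fun y hy => ?_, hη', by simp [hg.zero], by simp [hg.one]⟩
    have h1 := ((hg.deriv y hy).pow 2).div ((h.deriv y hy).hasDerivWithinAt.add_const δ) (hpos y hy)
    refine h1.congr_deriv ?_
    have := hpos y hy
    simp only [Pi.pow_apply]
    field_simp
    push_cast
    ring
  have hw := h.weak hη
  have hsplit : ∫ y in (0 : ℝ)..1, (g' y - g y * ψ y / (φ y + δ)) ^ 2
      = ∫ y in (0 : ℝ)..1, (g' y ^ 2
          - ψ y * (2 * g y * g' y / (φ y + δ) - g y ^ 2 * ψ y / (φ y + δ) ^ 2)) := by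
    refine intervalIntegral.integral_congr fun y hy => ?_
    rw [uIcc_of_le zero_le_one] at hy
    have := hpos y hy
    field_simp
    ring
  rw [hsplit, intervalIntegral.integral_sub, hw]
  · ring
  · exact ContinuousOn.intervalIntegrable (by rw [uIcc_of_le zero_le_one]; exact hg'c.pow 2)
  · exact ContinuousOn.intervalIntegrable (by rw [uIcc_of_le zero_le_one]; exact hψc.mul hη')

/-- As `δ → 0` the regularized Picone integral tends to the value at `g` of the quadratic form of
`-d²/dy² + 1 + V`. -/
theorem IsGroundState.tendsto_picone {ε lam : ℝ} {φ ψ g g' : ℝ → ℝ}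
    (h : IsGroundState ε lam φ ψ) (hg : IsTestFunction g g') :
    Tendsto (fun δ => ∫ y in (0 : ℝ)..1, (g' y - g y * ψ y / (φ y + δ)) ^ 2) (𝓝[>] 0)
      (𝓝 ((∫ y in (0 : ℝ)..1, g' y ^ 2)
        + ∫ y in (0 : ℝ)..1, (1 + rayleighPotential ε lam y) * g y ^ 2)) := by
  obtain ⟨B, hB0, hB⟩ := exists_abs_rayleighPotential_le h.ne
  have hW : ∀ y, |1 + rayleighPotential ε lam y| ≤ 1 + B := fun y =>
    (abs_add_le _ _).trans (by rw [abs_one]; linarith [hB y])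
  have hWm : Measurable fun y => 1 + rayleighPotential ε lam y :=
    measurable_const.add (measurable_rayleighPotential ε lam)
  have hφc := h.isTestFunction.continuousOn
  have hgc := hg.continuousOn
  have hlim : Tendsto (fun δ => ∫ y in (0 : ℝ)..1,
      (1 + rayleighPotential ε lam y) * (φ y * (g y ^ 2 / (φ y + δ)))) (𝓝[>] 0)
      (𝓝 (∫ y in (0 : ℝ)..1, (1 + rayleighPotential ε lam y) * g y ^ 2)) := by
    refine intervalIntegral.tendsto_integral_filter_of_dominated_convergence
      (fun y => (1 + B) * g y ^ 2) ?_ ?_ ?_ ?_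
    · filter_upwards [self_mem_nhdsWithin] with δ hδ
      have hc : ContinuousOn (fun y => φ y * (g y ^ 2 / (φ y + δ))) (Icc 0 1) :=
        hφc.mul ((hgc.pow 2).div (by fun_prop) fun y hy => by
          have := h.nonneg hy; have : 0 < δ := hδ; positivity)
      exact ((intervalIntegrable_iff.1
        (intervalIntegrable_mul_of_bounded hWm hW hc))).aestronglyMeasurable
    · filter_upwards [self_mem_nhdsWithin] with δ hδ
      refine ae_of_all _ fun y hy => ?_
      rw [uIoc_of_le zero_le_one] at hy
      have h1 := h.nonneg ⟨hy.1.le, hy.2⟩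
      have hδ' : 0 < δ := hδ
      rw [norm_mul, Real.norm_eq_abs, Real.norm_eq_abs]
      refine mul_le_mul (hW y) ?_ (abs_nonneg _) (by positivity)
      rw [abs_of_nonneg (by positivity), ← mul_div_assoc, div_le_iff₀ (by positivity)]
      nlinarith [sq_nonneg (g y)]
    · exact ContinuousOn.intervalIntegrable (by rw [uIcc_of_le zero_le_one]; fun_prop)
    · refine ae_of_all _ fun y hy => ?_
      rw [uIoc_of_le zero_le_one] at hy
      refine Tendsto.const_mul _ ?_
      rcases hy.2.eq_or_lt with h1 | h1
      · rw [h1, hg.one]; simp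
      · have hp := h.pos y ⟨hy.1, h1⟩
        have : Tendsto (fun δ => φ y * (g y ^ 2 / (φ y + δ))) (𝓝[>] 0)
            (𝓝 (φ y * (g y ^ 2 / (φ y + 0)))) := by
          refine Tendsto.mono_left (ContinuousAt.tendsto ?_) nhdsWithin_le_nhds
          exact continuousAt_const.mul (continuousAt_const.div (by fun_prop) (by simpa using hp.ne'))
        convert this using 2
        field_simp
        simp
  refine (tendsto_const_nhds.add hlim).congr' ?_
  filter_upwards [self_mem_nhdsWithin] with δ hδ
  exact (h.picone hg hδ).symm

/-- The lowest Dirichlet eigenvalue of `-d²/dy² + V` is at least `-1`. -/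
theorem IsGroundState.form_nonneg {ε lam : ℝ} {φ ψ g g' : ℝ → ℝ} (h : IsGroundState ε lam φ ψ)
    (hg : IsTestFunction g g') :
    0 ≤ (∫ y in (0 : ℝ)..1, g' y ^ 2)
        + ∫ y in (0 : ℝ)..1, (1 + rayleighPotential ε lam y) * g y ^ 2 :=
  ge_of_tendsto' (h.tendsto_picone hg) fun _ =>
    intervalIntegral.integral_nonneg zero_le_one fun _ _ => sq_nonneg _

/-- If the quadratic form vanishes at `g`, then `g / φ` has zero derivative in `(0, 1)`. -/
theorem IsGroundState.wronskian_eq_zero_of_form_eq_zero {ε lam : ℝ} {φ ψ g g' : ℝ → ℝ}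
    (h : IsGroundState ε lam φ ψ) (hg : IsTestFunction g g')
    (h0 : (∫ y in (0 : ℝ)..1, g' y ^ 2)
        + ∫ y in (0 : ℝ)..1, (1 + rayleighPotential ε lam y) * g y ^ 2 = 0)
    {y : ℝ} (hy : y ∈ Ioo (0 : ℝ) 1) : g' y * φ y = g y * ψ y := by
  obtain ⟨p, hp0, hpy⟩ := exists_between hy.1
  obtain ⟨r, hyr, hr1⟩ := exists_between hy.2
  have hpr : p ≤ r := (hpy.trans hyr).le
  have hsub : Icc p r ⊆ Icc 0 1 := Icc_subset_Icc hp0.le hr1.le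
  have hφpos : ∀ y ∈ Icc p r, 0 < φ y := fun y hy =>
    h.pos y ⟨hp0.trans_le hy.1, hy.2.trans_lt hr1⟩
  have hφc := h.isTestFunction.continuousOn.mono hsub
  have hgc := hg.continuousOn.mono hsub
  have hg'c := hg.cont.mono hsub
  have hψc := h.cont.mono hsub
  have hcont : ∀ δ, 0 ≤ δ → ContinuousOn (fun y => (g' y - g y * ψ y / (φ y + δ)) ^ 2) (Icc p r) :=
    fun δ hδ => (hg'c.sub ((hgc.mul hψc).div (by fun_prop) fun y hy => by
      have := hφpos y hy; positivity)).pow 2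
  have hlim : Tendsto (fun δ => ∫ y in p..r, (g' y - g y * ψ y / (φ y + δ)) ^ 2) (𝓝[>] 0)
      (𝓝 (∫ y in p..r, (g' y - g y * ψ y / φ y) ^ 2)) := by
    refine intervalIntegral.tendsto_integral_filter_of_dominated_convergence
      (fun y => (|g' y| + |g y * ψ y| / φ y) ^ 2) ?_ ?_ ?_ ?_
    · filter_upwards [self_mem_nhdsWithin] with δ hδ
      refine (ContinuousOn.aestronglyMeasurable ?_ measurableSet_uIoc)
      rw [uIoc_of_le hpr]
      exact (hcont δ (le_of_lt hδ)).mono Ioc_subset_Icc_self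
    · filter_upwards [self_mem_nhdsWithin] with δ hδ
      refine ae_of_all _ fun y hy => ?_
      rw [uIoc_of_le hpr] at hy
      have h1 := hφpos y ⟨hy.1.le, hy.2⟩
      have hδ' : 0 < δ := hδ
      rw [Real.norm_eq_abs, abs_pow]
      refine pow_le_pow_left₀ (abs_nonneg _) ((abs_sub _ _).trans (add_le_add le_rfl ?_)) 2
      rw [abs_div, abs_of_pos (by positivity : 0 < φ y + δ)]
      exact div_le_div_of_nonneg_left (abs_nonneg _) h1 (by linarith)
    · refine ContinuousOn.intervalIntegrable ?_
      rw [uIcc_of_le hpr]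
      exact (hg'c.abs.add ((hgc.mul hψc).abs.div hφc fun y hy => (hφpos y hy).ne')).pow 2
    · refine ae_of_all _ fun y hy => ?_
      rw [uIoc_of_le hpr] at hy
      have h1 := hφpos y ⟨hy.1.le, hy.2⟩
      have : ContinuousAt (fun δ => (g' y - g y * ψ y / (φ y + δ)) ^ 2) 0 :=
        (continuousAt_const.sub (continuousAt_const.div (by fun_prop)
          (by simpa using h1.ne'))).pow 2
      have h2 := this.tendsto.mono_left (nhdsWithin_le_nhds (s := Ioi 0))
      simpa using h2
  have hle : ∫ y in p..r, (g' y - g y * ψ y / φ y) ^ 2 ≤ 0 := by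
    rw [← h0]
    refine le_of_tendsto_of_tendsto hlim (h.tendsto_picone hg) ?_
    filter_upwards [self_mem_nhdsWithin] with δ hδ
    have hδ' : 0 < δ := hδ
    refine intervalIntegral.integral_mono_interval hp0.le hpr hr1.le
      (ae_of_all _ fun y => sq_nonneg _) (ContinuousOn.intervalIntegrable ?_)
    rw [uIcc_of_le zero_le_one]
    exact (hg.cont.sub ((hg.continuousOn.mul h.cont).div
      (h.isTestFunction.continuousOn.add continuousOn_const) fun y hy =>
        (add_pos_of_nonneg_of_pos (h.nonneg hy) hδ').ne')).pow 2
  have hcont0 : ContinuousOn (fun y => (g' y - g y * ψ y / φ y) ^ 2) (Icc p r) := by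
    simpa using hcont 0 le_rfl
  have hzero : (g' y - g y * ψ y / φ y) ^ 2 = 0 := by
    by_contra hne
    have := intervalIntegral.integral_pos (hpy.trans hyr) hcont0 (fun y _ => sq_nonneg _)
      ⟨y, ⟨hpy.le, hyr.le⟩, (sq_nonneg _).lt_of_ne' hne⟩
    linarith
  have h1 := hφpos y ⟨hpy.le, hyr.le⟩
  have h2 : g' y - g y * ψ y / φ y = 0 := by simpa using hzero
  field_simp at h2
  linarith

/-- The eigenvalue `-1` is simple: the quadratic form vanishes only at multiples of `φ`. -/
theorem IsGroundState.eq_smul_of_form_eq_zero {ε lam : ℝ} {φ ψ g g' : ℝ → ℝ}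
    (h : IsGroundState ε lam φ ψ) (hg : IsTestFunction g g')
    (h0 : (∫ y in (0 : ℝ)..1, g' y ^ 2)
        + ∫ y in (0 : ℝ)..1, (1 + rayleighPotential ε lam y) * g y ^ 2 = 0) :
    ∃ c, ∀ y ∈ Icc (0 : ℝ) 1, g y = c * φ y := by
  have hder : ∀ y ∈ Ioo (0 : ℝ) 1, HasDerivAt (fun y => g y / φ y) 0 y := by
    intro y hy
    have hy' : y ∈ Icc (0 : ℝ) 1 := ⟨hy.1.le, hy.2.le⟩
    have h1 := ((hg.deriv y hy').hasDerivAt (Icc_mem_nhds hy.1 hy.2)).div (h.deriv y hy')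
      (h.pos y hy).ne'
    refine h1.congr_deriv ?_
    rw [h.wronskian_eq_zero_of_form_eq_zero hg h0 hy]
    simp
  have hconst : ∀ y ∈ Ioo (0 : ℝ) 1, g y / φ y = g (1 / 2) / φ (1 / 2) := by
    intro y hy
    refine (convex_Ioo (0 : ℝ) 1).is_const_of_fderivWithin_eq_zero (𝕜 := ℝ)
      (f := fun y => g y / φ y)
      (fun z hz => (hder z hz).differentiableAt.differentiableWithinAt) (fun z hz => ?_) hy
      (by norm_num)
    rw [fderivWithin_of_isOpen isOpen_Ioo hz]
    have h2 := (hder z hz).hasFDerivAt.fderiv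
    rw [h2]; ext; simp
  refine ⟨g (1 / 2) / φ (1 / 2), fun y hy => ?_⟩
  rcases hy.1.eq_or_lt with h1 | h1
  · rw [← h1, hg.zero, h.zero, mul_zero]
  rcases hy.2.eq_or_lt with h2 | h2
  · rw [h2, hg.one, h.one, mul_zero]
  · rw [← hconst y ⟨h1, h2⟩]
    have := h.pos y ⟨h1, h2⟩
    field_simp

/-! ### Functions on the channel -/

/-- The universal cover `ℝ × [0, 1]` of the channel. -/
def strip : Set (ℝ × ℝ) := univ ×ˢ Icc (0 : ℝ) 1

theorem uniqueDiffOn_strip : UniqueDiffOn ℝ strip :=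
  uniqueDiffOn_univ.prod (uniqueDiffOn_Icc zero_lt_one)

theorem lift_apply {K : Set ℝ} (f : Torus × K → ℝ) (x : ℝ) {y : ℝ} (hy : y ∈ K) :
    lift K f (x, y) = f ((x : Torus), ⟨y, hy⟩) := by
  simp [lift, hy]

/-- Extension by clamping `y` to `[0, 1]`; it makes the lemmas on parametric integrals applicable. -/
theorem exists_continuous_eqOn_strip {F : ℝ × ℝ → ℝ} (hF : ContinuousOn F strip) :
    ∃ G : ℝ × ℝ → ℝ, Continuous G ∧ EqOn F G strip := by
  refine ⟨fun p => F (p.1, max 0 (min 1 p.2)), ?_, ?_⟩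
  · refine hF.comp_continuous (by fun_prop) fun p => ⟨mem_univ _, le_max_left _ _, ?_⟩
    exact max_le zero_le_one (min_le_left _ _)
  · rintro ⟨x, y⟩ ⟨-, hy⟩
    simp only
    rw [min_eq_right hy.2, max_eq_right hy.1]

theorem continuous_integral_strip {F : ℝ × ℝ → ℝ} (hF : ContinuousOn F strip) :
    Continuous fun x => ∫ y in (0 : ℝ)..1, F (x, y) := by
  obtain ⟨G, hG, hFG⟩ := exists_continuous_eqOn_strip hF
  have : (fun x => ∫ y in (0 : ℝ)..1, F (x, y)) = fun x => ∫ y in (0 : ℝ)..1, G (x, y) := by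
    funext x
    refine intervalIntegral.integral_congr fun y hy => ?_
    rw [uIcc_of_le zero_le_one] at hy
    exact hFG ⟨mem_univ _, hy⟩
  rw [this]
  exact intervalIntegral.continuous_parametric_intervalIntegral_of_continuous'
    (f := fun x y => G (x, y)) hG 0 1

theorem continuousOn_integral_strip {F : ℝ × ℝ → ℝ} (hF : ContinuousOn F strip) (r : ℝ) :
    ContinuousOn (fun y => ∫ x in (0 : ℝ)..r, F (x, y)) (Icc 0 1) := by
  obtain ⟨G, hG, hFG⟩ := exists_continuous_eqOn_strip hF
  have hc : Continuous fun y => ∫ x in (0 : ℝ)..r, G (x, y) :=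
    intervalIntegral.continuous_parametric_intervalIntegral_of_continuous'
      (f := fun y x => G (x, y)) (hG.comp continuous_swap) 0 r
  exact hc.continuousOn.congr fun y hy =>
    intervalIntegral.integral_congr fun x _ => hFG ⟨mem_univ _, hy⟩

theorem intervalIntegrable_slice {F : ℝ × ℝ → ℝ} (hF : ContinuousOn F strip) (x : ℝ) :
    IntervalIntegrable (fun y => F (x, y)) volume 0 1 := by
  refine ContinuousOn.intervalIntegrable ?_
  rw [uIcc_of_le zero_le_one]
  exact hF.comp (f := fun y => (x, y)) (by fun_prop) fun y hy => ⟨mem_univ _, hy⟩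

theorem continuous_slice {F : ℝ × ℝ → ℝ} (hF : ContinuousOn F strip) {y : ℝ}
    (hy : y ∈ Icc (0 : ℝ) 1) : Continuous fun x => F (x, y) :=
  hF.comp_continuous (by fun_prop) fun _ => ⟨mem_univ _, hy⟩

/-- Fubini's theorem on one period of the strip. The weight accommodates the jumps of `V`. -/
theorem integral_swap_weighted {w : ℝ → ℝ} {B : ℝ} (hw : Measurable w) (hB : ∀ y, |w y| ≤ B)
    {F : ℝ × ℝ → ℝ} (hF : ContinuousOn F strip) :
    ∫ x in (0 : ℝ)..(2 * Real.pi), ∫ y in (0 : ℝ)..1, w y * F (x, y)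
      = ∫ y in (0 : ℝ)..1, w y * ∫ x in (0 : ℝ)..(2 * Real.pi), F (x, y) := by
  obtain ⟨G, hG, hFG⟩ := exists_continuous_eqOn_strip hF
  have h1 : ∫ x in (0 : ℝ)..(2 * Real.pi), ∫ y in (0 : ℝ)..1, w y * F (x, y)
      = ∫ x in (0 : ℝ)..(2 * Real.pi), ∫ y in (0 : ℝ)..1, w y * G (x, y) := by
    refine intervalIntegral.integral_congr fun x _ => intervalIntegral.integral_congr fun y hy => ?_
    rw [uIcc_of_le zero_le_one] at hy
    rw [hFG (⟨mem_univ _, hy⟩ : (x, y) ∈ strip)]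
  have h2 : ∫ y in (0 : ℝ)..1, w y * ∫ x in (0 : ℝ)..(2 * Real.pi), F (x, y)
      = ∫ y in (0 : ℝ)..1, ∫ x in (0 : ℝ)..(2 * Real.pi), w y * G (x, y) := by
    refine intervalIntegral.integral_congr fun y hy => ?_
    rw [uIcc_of_le zero_le_one] at hy
    rw [← intervalIntegral.integral_const_mul]
    refine intervalIntegral.integral_congr fun x _ => ?_
    rw [hFG (⟨mem_univ _, hy⟩ : (x, y) ∈ strip)]
  rw [h1, h2]
  refine intervalIntegral_intervalIntegral_swap ?_
  have hGi : IntegrableOn G (Icc 0 (2 * Real.pi) ×ˢ Icc 0 1) (volume.prod volume) :=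
    hG.continuousOn.integrableOn_compact (isCompact_Icc.prod isCompact_Icc)
  have hGi' := hGi.mono_set (s := uIoc 0 (2 * Real.pi) ×ˢ uIoc (0 : ℝ) 1) (prod_mono
    (by rw [uIoc_of_le Real.two_pi_pos.le]; exact Ioc_subset_Icc_self)
    (by rw [uIoc_of_le zero_le_one]; exact Ioc_subset_Icc_self))
  exact hGi'.bdd_mul (c := B) (hw.comp measurable_snd).aestronglyMeasurable
    (ae_of_all _ fun p => hB p.2)

/-- Differentiation in `y` under the integral in `x`, one-sided at the walls. -/
theorem hasDerivWithinAt_integral_strip {P Q : ℝ × ℝ → ℝ} (hP : ContinuousOn P strip)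
    (hQ : ContinuousOn Q strip)
    (hPQ : ∀ x, ∀ y ∈ Icc (0 : ℝ) 1,
      HasDerivWithinAt (fun y => P (x, y)) (Q (x, y)) (Icc 0 1) y)
    (r : ℝ) {y : ℝ} (hy : y ∈ Icc (0 : ℝ) 1) :
    HasDerivWithinAt (fun y => ∫ x in (0 : ℝ)..r, P (x, y)) (∫ x in (0 : ℝ)..r, Q (x, y))
      (Icc 0 1) y := by
  obtain ⟨G, hG, hQG⟩ := exists_continuous_eqOn_strip hQ
  have hc : Continuous fun y => ∫ x in (0 : ℝ)..r, G (x, y) :=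
    intervalIntegral.continuous_parametric_intervalIntegral_of_continuous'
      (f := fun y x => G (x, y)) (hG.comp continuous_swap) 0 r
  have hftc : ∀ z ∈ Icc (0 : ℝ) 1, ∀ x, P (x, z) = P (x, 0) + ∫ t in (0 : ℝ)..z, G (x, t) := by
    intro z hz x
    have := integral_eq_of_hasDerivAt_off_countable_of_le (fun y => P (x, y))
      (fun y => G (x, y)) hz.1 countable_empty
      (hP.comp (f := fun y => (x, y)) (by fun_prop) fun y hy => ⟨mem_univ _, hy.1, hy.2.trans hz.2⟩)
      (fun t ht => by
        have ht1 : t < 1 := ht.1.2.trans_le hz.2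
        rw [← hQG (⟨mem_univ _, ht.1.1.le, ht1.le⟩ : (x, t) ∈ strip)]
        exact (hPQ x t ⟨ht.1.1.le, ht1.le⟩).hasDerivAt (Icc_mem_nhds ht.1.1 ht1))
      (Continuous.intervalIntegrable (by fun_prop) _ _)
    linarith
  have hprim : ∀ z ∈ Icc (0 : ℝ) 1, ∫ x in (0 : ℝ)..r, P (x, z)
      = (∫ x in (0 : ℝ)..r, P (x, 0)) + ∫ t in (0 : ℝ)..z, ∫ x in (0 : ℝ)..r, G (x, t) := by
    intro z hz
    have h0 : (0 : ℝ) ∈ Icc (0 : ℝ) 1 := by norm_num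
    have hGz : Continuous fun x => ∫ t in (0 : ℝ)..z, G (x, t) :=
      intervalIntegral.continuous_parametric_intervalIntegral_of_continuous'
        (f := fun x t => G (x, t)) hG 0 z
    rw [intervalIntegral.integral_congr (g := fun x => P (x, 0) + ∫ t in (0 : ℝ)..z, G (x, t))
      (fun x _ => hftc z hz x), intervalIntegral.integral_add
      ((continuous_slice hP h0).intervalIntegrable _ _) (hGz.intervalIntegrable _ _)]
    congr 1
    refine intervalIntegral_intervalIntegral_swap (F := fun x t => G (x, t)) ?_
    have hGi : IntegrableOn G (uIcc 0 r ×ˢ uIcc 0 z) (volume.prod volume) :=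
      hG.continuousOn.integrableOn_compact (isCompact_uIcc.prod isCompact_uIcc)
    exact hGi.mono_set (prod_mono uIoc_subset_uIcc uIoc_subset_uIcc)
  have hd : HasDerivAt (fun z => (∫ x in (0 : ℝ)..r, P (x, 0))
      + ∫ t in (0 : ℝ)..z, ∫ x in (0 : ℝ)..r, G (x, t)) (∫ x in (0 : ℝ)..r, G (x, y)) y :=
    (intervalIntegral.integral_hasDerivAt_right (hc.intervalIntegrable 0 y)
      (hc.stronglyMeasurableAtFilter _ _) hc.continuousAt).const_add _
  have hQy : ∫ x in (0 : ℝ)..r, Q (x, y) = ∫ x in (0 : ℝ)..r, G (x, y) :=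
    intervalIntegral.integral_congr fun x _ => hQG ⟨mem_univ _, hy⟩
  rw [hQy]
  exact hd.hasDerivWithinAt.congr hprim (hprim y hy)

/-- The closed channel `𝕋 × [0, 1]`. -/
abbrev Channel : Type := Torus × Icc (0 : ℝ) 1

theorem IsC1.continuousOn {f : Channel → ℝ} (hf : IsC1 (Icc 0 1) f) :
    ContinuousOn (lift (Icc 0 1) f) strip := ContDiffOn.continuousOn hf

theorem IsC1.continuousOn_dx {f : Channel → ℝ} (hf : IsC1 (Icc 0 1) f) :
    ContinuousOn (dx f) strip :=
  (ContDiffOn.continuousOn_fderivWithin hf uniqueDiffOn_strip le_rfl).clm_apply continuousOn_const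

theorem IsC1.continuousOn_dy {f : Channel → ℝ} (hf : IsC1 (Icc 0 1) f) :
    ContinuousOn (dy f) strip :=
  (ContDiffOn.continuousOn_fderivWithin hf uniqueDiffOn_strip le_rfl).clm_apply continuousOn_const

theorem IsC1.hasFDerivWithinAt {f : Channel → ℝ} (hf : IsC1 (Icc 0 1) f) {p : ℝ × ℝ}
    (hp : p ∈ strip) : HasFDerivWithinAt (lift (Icc 0 1) f)
      (fderivWithin ℝ (lift (Icc 0 1) f) strip p) strip p :=
  ((ContDiffOn.differentiableOn hf one_ne_zero) p hp).hasFDerivWithinAt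

theorem IsC1.hasDerivAt_dx {f : Channel → ℝ} (hf : IsC1 (Icc 0 1) f) (x : ℝ) {y : ℝ}
    (hy : y ∈ Icc (0 : ℝ) 1) :
    HasDerivAt (fun x => lift (Icc 0 1) f (x, y)) (dx f (x, y)) x := by
  have h1 : HasDerivWithinAt (fun x : ℝ => (x, y)) ((1 : ℝ), (0 : ℝ)) univ x :=
    ((hasDerivAt_id x).prodMk (hasDerivAt_const x y)).hasDerivWithinAt
  have h2 := (hf.hasFDerivWithinAt (p := (x, y)) ⟨mem_univ _, hy⟩).comp_hasDerivWithinAt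
    x h1 (fun z _ => (⟨mem_univ _, hy⟩ : (z, y) ∈ strip))
  exact hasDerivWithinAt_univ.1 h2

theorem IsC1.hasDerivWithinAt_dy {f : Channel → ℝ} (hf : IsC1 (Icc 0 1) f) (x : ℝ) {y : ℝ}
    (hy : y ∈ Icc (0 : ℝ) 1) :
    HasDerivWithinAt (fun y => lift (Icc 0 1) f (x, y)) (dy f (x, y)) (Icc 0 1) y := by
  have h1 : HasDerivWithinAt (fun y : ℝ => (x, y)) ((0 : ℝ), (1 : ℝ)) (Icc 0 1) y :=
    ((hasDerivAt_const y x).prodMk (hasDerivAt_id y)).hasDerivWithinAt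
  exact (hf.hasFDerivWithinAt (p := (x, y)) ⟨mem_univ _, hy⟩).comp_hasDerivWithinAt
    y h1 (fun z hz => (⟨mem_univ _, hz⟩ : (x, z) ∈ strip))

theorem dx_eq {f : Channel → ℝ} (hf : IsC1 (Icc 0 1) f) {x y d : ℝ} (hy : y ∈ Icc (0 : ℝ) 1)
    (h : HasDerivAt (fun x => lift (Icc 0 1) f (x, y)) d x) : dx f (x, y) = d :=
  (hf.hasDerivAt_dx x hy).unique h

theorem dy_eq {f : Channel → ℝ} (hf : IsC1 (Icc 0 1) f) {x y d : ℝ} (hy : y ∈ Icc (0 : ℝ) 1)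
    (h : HasDerivWithinAt (fun y => lift (Icc 0 1) f (x, y)) d (Icc 0 1) y) : dy f (x, y) = d :=
  (uniqueDiffOn_Icc zero_lt_one y hy).eq_deriv _ (hf.hasDerivWithinAt_dy x hy) h

/-! ### Separated functions and Fourier modes -/

theorem cos_periodic (k : ℕ) : Function.Periodic (fun x : ℝ => Real.cos (k * x)) (2 * Real.pi) := by
  intro x
  simp only
  rw [mul_add, Real.cos_add_nat_mul_two_pi]

/-- The function `cos (k x)` on the torus. -/
noncomputable def cosMode (k : ℕ) : Torus → ℝ := (cos_periodic k).lift

theorem cosMode_coe (k : ℕ) (x : ℝ) : cosMode k (x : Torus) = Real.cos (k * x) :=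
  (cos_periodic k).lift_coe x

/-- The function `cos (k x) g(y)`. -/
noncomputable def separated (K : Set ℝ) (k : ℕ) (g : ℝ → ℝ) : Torus × K → ℝ :=
  fun p => cosMode k p.1 * g p.2

theorem lift_separated {K : Set ℝ} (k : ℕ) (g : ℝ → ℝ) (x : ℝ) {y : ℝ} (hy : y ∈ K) :
    lift K (separated K k g) (x, y) = Real.cos (k * x) * g y := by
  rw [lift_apply _ _ hy, separated, cosMode_coe]

theorem hasDerivAt_cos_mul (k : ℕ) (x : ℝ) :
    HasDerivAt (fun x : ℝ => Real.cos (k * x)) (-(k * Real.sin (k * x))) x := by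
  have := ((hasDerivAt_id x).const_mul (k : ℝ)).cos
  refine this.congr_deriv ?_
  simp; ring

theorem hasDerivAt_sin_mul (k : ℕ) (x : ℝ) :
    HasDerivAt (fun x : ℝ => Real.sin (k * x)) (k * Real.cos (k * x)) x := by
  have := ((hasDerivAt_id x).const_mul (k : ℝ)).sin
  refine this.congr_deriv ?_
  simp; ring

theorem isC1_separated (k : ℕ) {g g' : ℝ → ℝ} (hg : IsTestFunction g g') :
    IsC1 (Icc 0 1) (separated (Icc 0 1) k g) := by
  have hu : UniqueDiffOn ℝ (Icc (0 : ℝ) 1) := uniqueDiffOn_Icc zero_lt_one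
  have hg1 : ContDiffOn ℝ 1 g (Icc 0 1) := by
    rw [show (1 : WithTop ℕ∞) = 0 + 1 by simp, contDiffOn_succ_iff_derivWithin hu]
    refine ⟨fun y hy => (hg.deriv y hy).differentiableWithinAt, by simp, ?_⟩
    rw [contDiffOn_zero]
    exact hg.cont.congr fun y hy => (hg.deriv y hy).derivWithin (hu y hy)
  have hg2 : ContDiffOn ℝ 1 (fun p : ℝ × ℝ => g p.2) (univ ×ˢ Icc 0 1) :=
    hg1.comp contDiff_snd.contDiffOn fun p hp => hp.2
  have hc : ContDiff ℝ 1 fun p : ℝ × ℝ => Real.cos (k * p.1) := by fun_prop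
  exact (hc.contDiffOn.mul hg2).congr fun p hp => lift_separated k g p.1 hp.2

theorem dx_separated (k : ℕ) {g g' : ℝ → ℝ} (hg : IsTestFunction g g') (x : ℝ) {y : ℝ}
    (hy : y ∈ Icc (0 : ℝ) 1) :
    dx (separated (Icc 0 1) k g) (x, y) = -(k * Real.sin (k * x)) * g y := by
  refine dx_eq (isC1_separated k hg) hy ?_
  simp_rw [fun x => lift_separated k g x hy]
  exact (hasDerivAt_cos_mul k x).mul_const _

theorem dy_separated (k : ℕ) {g g' : ℝ → ℝ} (hg : IsTestFunction g g') (x : ℝ) {y : ℝ}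
    (hy : y ∈ Icc (0 : ℝ) 1) :
    dy (separated (Icc 0 1) k g) (x, y) = Real.cos (k * x) * g' y := by
  refine dy_eq (isC1_separated k hg) hy ?_
  exact ((hg.deriv y hy).const_mul _).congr (fun z hz => lift_separated k g x hz)
    (lift_separated k g x hy)

theorem vanishesOnWalls_separated (k : ℕ) {g g' : ℝ → ℝ} (hg : IsTestFunction g g') :
    VanishesOnWalls (separated (Icc 0 1) k g) := by
  rintro x y (hy | hy) <;> simp [separated, hy, hg.zero, hg.one]

/-- The `k`-th cosine coefficient of `f(·, y)`, not normalized. -/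
noncomputable def mode (k : ℕ) (f : Channel → ℝ) (y : ℝ) : ℝ :=
  ∫ x in (0 : ℝ)..(2 * Real.pi), Real.cos (k * x) * lift (Icc 0 1) f (x, y)

/-- The `y`-derivative of `mode k f`. -/
noncomputable def modeDeriv (k : ℕ) (f : Channel → ℝ) (y : ℝ) : ℝ :=
  ∫ x in (0 : ℝ)..(2 * Real.pi), Real.cos (k * x) * dy f (x, y)

theorem continuousOn_cos_mul (k : ℕ) {F : ℝ × ℝ → ℝ} (hF : ContinuousOn F strip) :
    ContinuousOn (fun p : ℝ × ℝ => Real.cos (k * p.1) * F p) strip :=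
  (Continuous.continuousOn (by fun_prop)).mul hF

theorem isTestFunction_mode (k : ℕ) {f : Channel → ℝ} (hf : IsC1 (Icc 0 1) f)
    (hw : VanishesOnWalls f) : IsTestFunction (mode k f) (modeDeriv k f) := by
  have hvan : ∀ y ∈ Icc (0 : ℝ) 1, y = 0 ∨ y = 1 → mode k f y = 0 := by
    intro y hy h
    unfold mode
    simp_rw [fun x => lift_apply f x hy, fun x : ℝ => hw (x : Torus) ⟨y, hy⟩ h]
    simp
  refine ⟨fun y hy => ?_, ?_, hvan 0 (by norm_num) (Or.inl rfl), hvan 1 (by norm_num) (Or.inr rfl)⟩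
  · exact hasDerivWithinAt_integral_strip (continuousOn_cos_mul k hf.continuousOn)
      (continuousOn_cos_mul k hf.continuousOn_dy)
      (fun x y hy => (hf.hasDerivWithinAt_dy x hy).const_mul (Real.cos (k * x))) _ hy
  · exact continuousOn_integral_strip (continuousOn_cos_mul k hf.continuousOn_dy) _

/-- Integration by parts in `x`; the boundary terms cancel because `sin (k x)` vanishes at `0` and
`2π`. -/
theorem integral_sin_mul_dx (k : ℕ) {f : Channel → ℝ} (hf : IsC1 (Icc 0 1) f) {y : ℝ}
    (hy : y ∈ Icc (0 : ℝ) 1) :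
    ∫ x in (0 : ℝ)..(2 * Real.pi), -(k * Real.sin (k * x)) * dx f (x, y)
      = (k : ℝ) ^ 2 * mode k f y := by
  have hFc := continuous_slice hf.continuousOn hy
  have hdc := continuous_slice hf.continuousOn_dx hy
  have hi1 : IntervalIntegrable (fun x : ℝ => -(k * Real.sin (k * x)) * dx f (x, y)) volume 0
      (2 * Real.pi) := Continuous.intervalIntegrable (by fun_prop) _ _
  have hi2 : IntervalIntegrable
      (fun x : ℝ => (k : ℝ) ^ 2 * (Real.cos (k * x) * lift (Icc 0 1) f (x, y))) volume 0
      (2 * Real.pi) := Continuous.intervalIntegrable (by fun_prop) _ _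
  have key := intervalIntegral.integral_eq_sub_of_hasDerivAt (a := 0) (b := 2 * Real.pi)
    (f := fun x => -(k * Real.sin (k * x)) * lift (Icc 0 1) f (x, y))
    (f' := fun x => -(k * Real.sin (k * x)) * dx f (x, y)
      - (k : ℝ) ^ 2 * (Real.cos (k * x) * lift (Icc 0 1) f (x, y)))
    (fun x _ => by
      refine ((((hasDerivAt_sin_mul k x).const_mul (k : ℝ)).neg).mul
        (hf.hasDerivAt_dx x hy)).congr_deriv ?_
      simp only [Pi.neg_apply]
      ring) (hi1.sub hi2)
  rw [intervalIntegral.integral_sub hi1 hi2, intervalIntegral.integral_const_mul] at key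
  have h0 : Real.sin (k * (2 * Real.pi)) = 0 := by
    rw [show (k : ℝ) * (2 * Real.pi) = 0 + k * (2 * Real.pi) by ring,
      Real.sin_add_nat_mul_two_pi, Real.sin_zero]
  simp only [h0, mul_zero, Real.sin_zero, neg_zero, zero_mul, sub_zero] at key
  unfold mode
  linarith

/-- The Dirichlet form of `f` against `cos (k x) g(y)`. -/
theorem dirichlet_separated (k : ℕ) {f : Channel → ℝ} (hf : IsC1 (Icc 0 1) f) {g g' : ℝ → ℝ}
    (hg : IsTestFunction g g') :
    (∫ x in (0 : ℝ)..(2 * Real.pi), ∫ y in (0 : ℝ)..1,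
        (dx f (x, y) * dx (separated (Icc 0 1) k g) (x, y)
          + dy f (x, y) * dy (separated (Icc 0 1) k g) (x, y)))
      = ∫ y in (0 : ℝ)..1, ((k : ℝ) ^ 2 * (mode k f y * g y) + modeDeriv k f y * g' y) := by
  have hgs : ContinuousOn (fun p : ℝ × ℝ => g p.2) strip :=
    hg.continuousOn.comp continuousOn_snd fun p hp => hp.2
  have hg's : ContinuousOn (fun p : ℝ × ℝ => g' p.2) strip :=
    hg.cont.comp continuousOn_snd fun p hp => hp.2
  have hF : ContinuousOn (fun p : ℝ × ℝ => -(k * Real.sin (k * p.1)) * dx f p * g p.2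
      + Real.cos (k * p.1) * dy f p * g' p.2) strip :=
    (((Continuous.continuousOn (by fun_prop)).mul hf.continuousOn_dx).mul hgs).add
      ((continuousOn_cos_mul k hf.continuousOn_dy).mul hg's)
  have h1 : (∫ x in (0 : ℝ)..(2 * Real.pi), ∫ y in (0 : ℝ)..1,
        (dx f (x, y) * dx (separated (Icc 0 1) k g) (x, y)
          + dy f (x, y) * dy (separated (Icc 0 1) k g) (x, y)))
      = ∫ x in (0 : ℝ)..(2 * Real.pi), ∫ y in (0 : ℝ)..1, 1 *
        (-(k * Real.sin (k * x)) * dx f (x, y) * g y + Real.cos (k * x) * dy f (x, y) * g' y) := by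
    refine intervalIntegral.integral_congr fun x _ => intervalIntegral.integral_congr fun y hy => ?_
    rw [uIcc_of_le zero_le_one] at hy
    rw [dx_separated k hg x hy, dy_separated k hg x hy]
    ring
  rw [h1, integral_swap_weighted (w := fun _ => 1) (B := 1) measurable_const (by simp) hF]
  refine intervalIntegral.integral_congr fun y hy => ?_
  rw [uIcc_of_le zero_le_one] at hy
  have hdx := continuous_slice hf.continuousOn_dx hy
  have hdy := continuous_slice hf.continuousOn_dy hy
  simp only [one_mul]
  rw [intervalIntegral.integral_add (Continuous.intervalIntegrable (by fun_prop) _ _)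
    (Continuous.intervalIntegrable (by fun_prop) _ _), intervalIntegral.integral_mul_const,
    intervalIntegral.integral_mul_const, integral_sin_mul_dx k hf hy, modeDeriv]
  ring

theorem weighted_separated (k : ℕ) {w : ℝ → ℝ} {B : ℝ} (hw : Measurable w) (hB : ∀ y, |w y| ≤ B)
    {f : Channel → ℝ} (hf : IsC1 (Icc 0 1) f) {g g' : ℝ → ℝ} (hg : IsTestFunction g g') :
    (∫ x in (0 : ℝ)..(2 * Real.pi), ∫ y in (0 : ℝ)..1,
        w y * (lift (Icc 0 1) f (x, y) * lift (Icc 0 1) (separated (Icc 0 1) k g) (x, y)))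
      = ∫ y in (0 : ℝ)..1, w y * (mode k f y * g y) := by
  rw [integral_swap_weighted hw hB
    (F := fun p => lift (Icc 0 1) f p * lift (Icc 0 1) (separated (Icc 0 1) k g) p)
    (hf.continuousOn.mul (isC1_separated k hg).continuousOn)]
  refine intervalIntegral.integral_congr fun y hy => ?_
  rw [uIcc_of_le zero_le_one] at hy
  rw [mode, ← intervalIntegral.integral_mul_const]
  congr 1
  refine intervalIntegral.integral_congr fun x _ => ?_
  rw [lift_separated k g x hy]
  ring

/-! ### Stream functions: the explicit one, and uniqueness -/

/-- If `(lam - Ψ₀') h` is the restriction of `f`, then the vorticity variation of `h` is `V f`. -/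
theorem vorticityVariation_eq {ε lam : ℝ} (hne : ∀ y ∈ closedDom ε, lam - Psi0Deriv ε y ≠ 0)
    {h : Torus × dom ε → ℝ} {f : Channel → ℝ}
    (hf : ∀ (x : Torus) (y : dom ε), (lam - Psi0Deriv ε y) * h (x, y) = f (x, ⟨y, y.2.1⟩))
    (x : ℝ) {y : ℝ} (hy : y ∈ Icc (0 : ℝ) 1) :
    vorticityVariation ε h (x, y) = rayleighPotential ε lam y * lift (Icc 0 1) f (x, y) := by
  unfold vorticityVariation rayleighPotential profileDeriv
  by_cases hd : y ∈ dom ε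
  · have h1 := hf x ⟨y, hd⟩
    have h2 := hne y (dom_subset_closedDom ε hd)
    simp only at h1
    rw [if_pos hd, if_pos hd, lift_apply f x hy, ← h1, lift_apply h x hd]
    field_simp
  · rw [if_neg hd, if_neg hd]; simp

/-- The factor depending on `y` of the kernel element: `φ / (lam - Ψ₀')`. -/
noncomputable def kernelProfile (ε lam : ℝ) (φ : ℝ → ℝ) (y : ℝ) : ℝ :=
  φ y / (lam - Psi0Deriv ε y)

/-- `φ(y) cos x` is the stream function variation of the kernel element: tested with `η`, the weak
Dirichlet problem reduces to the weak equation for `φ` tested with the first cosine mode of `η`. -/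
theorem IsGroundState.isStreamVariation {ε lam : ℝ} {φ ψ : ℝ → ℝ} (h : IsGroundState ε lam φ ψ) :
    IsStreamVariation ε (separated (dom ε) 1 (kernelProfile ε lam φ))
      (separated (Icc 0 1) 1 φ) := by
  have ht := h.isTestFunction
  obtain ⟨B, hB0, hB⟩ := exists_abs_rayleighPotential_le h.ne
  refine ⟨isC1_separated 1 ht, vanishesOnWalls_separated 1 ht, fun η hη hηw => ?_⟩
  have hm := isTestFunction_mode 1 hη hηw
  have e1 := dirichlet_separated 1 hη ht
  have e2 := weighted_separated 1 (measurable_rayleighPotential ε lam) hB hη ht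
  have e3 := h.weak hm
  have hrel : ∀ (x : Torus) (y : dom ε), (lam - Psi0Deriv ε y)
      * separated (dom ε) 1 (kernelProfile ε lam φ) (x, y)
        = separated (Icc 0 1) 1 φ (x, ⟨y, y.2.1⟩) := by
    intro x y
    have := h.ne y (dom_subset_closedDom ε y.2)
    simp only [separated, kernelProfile]
    field_simp
  have e4 : ∫ x in (0 : ℝ)..(2 * Real.pi), ∫ y in (0 : ℝ)..1,
        vorticityVariation ε (separated (dom ε) 1 (kernelProfile ε lam φ)) (x, y)
          * lift (Icc 0 1) η (x, y)
      = ∫ y in (0 : ℝ)..1, rayleighPotential ε lam y * (mode 1 η y * φ y) := by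
    rw [← e2]
    refine intervalIntegral.integral_congr fun x _ => intervalIntegral.integral_congr fun y hy => ?_
    rw [uIcc_of_le zero_le_one] at hy
    rw [vorticityVariation_eq h.ne hrel x hy]
    ring
  rw [e4]
  have e5 : ∫ x in (0 : ℝ)..(2 * Real.pi), ∫ y in (0 : ℝ)..1,
        (dx (separated (Icc 0 1) 1 φ) (x, y) * dx η (x, y)
          + dy (separated (Icc 0 1) 1 φ) (x, y) * dy η (x, y))
      = ∫ y in (0 : ℝ)..1, (((1 : ℕ) : ℝ) ^ 2 * (mode 1 η y * φ y) + modeDeriv 1 η y * ψ y) := by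
    rw [← e1]
    refine intervalIntegral.integral_congr fun x _ => intervalIntegral.integral_congr fun y _ => ?_
    ring
  have hmφ : ContinuousOn (fun y => mode 1 η y * φ y) (Icc 0 1) :=
    hm.continuousOn.mul ht.continuousOn
  have hi1 : IntervalIntegrable (fun y => mode 1 η y * φ y) volume 0 1 :=
    ContinuousOn.intervalIntegrable (by rwa [uIcc_of_le zero_le_one])
  have hi2 : IntervalIntegrable (fun y => modeDeriv 1 η y * ψ y) volume 0 1 :=
    ContinuousOn.intervalIntegrable (by rw [uIcc_of_le zero_le_one]; exact hm.cont.mul ht.cont)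
  have hi3 := intervalIntegrable_mul_of_bounded (measurable_rayleighPotential ε lam) hB hmφ
  have e6 : ∫ y in (0 : ℝ)..1, modeDeriv 1 η y * ψ y
      = -((∫ y in (0 : ℝ)..1, mode 1 η y * φ y)
        + ∫ y in (0 : ℝ)..1, rayleighPotential ε lam y * (mode 1 η y * φ y)) := by
    rw [← intervalIntegral.integral_add hi1 hi3]
    rw [intervalIntegral.integral_congr (g := fun y => ψ y * modeDeriv 1 η y)
      fun y _ => mul_comm (modeDeriv 1 η y) (ψ y), e3]
    congr 1
    refine intervalIntegral.integral_congr fun y _ => ?_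
    ring
  rw [e5, intervalIntegral.integral_add (hi1.const_mul _) hi2, e6,
    intervalIntegral.integral_const_mul]
  push_cast
  ring

theorem lift_sub (K : Set ℝ) (f g : Torus × K → ℝ) : lift K (f - g) = lift K f - lift K g := by
  funext p
  by_cases hp : p.2 ∈ K <;> simp [lift, hp]

theorem IsC1.sub {f g : Channel → ℝ} (hf : IsC1 (Icc 0 1) f) (hg : IsC1 (Icc 0 1) g) :
    IsC1 (Icc 0 1) (f - g) := by
  unfold IsC1
  rw [lift_sub]
  exact ContDiffOn.sub hf hg

theorem integral_strip_sub {F G : ℝ × ℝ → ℝ} (hF : ContinuousOn F strip)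
    (hG : ContinuousOn G strip) :
    ∫ x in (0 : ℝ)..(2 * Real.pi), ∫ y in (0 : ℝ)..1, (F (x, y) - G (x, y))
      = (∫ x in (0 : ℝ)..(2 * Real.pi), ∫ y in (0 : ℝ)..1, F (x, y))
        - ∫ x in (0 : ℝ)..(2 * Real.pi), ∫ y in (0 : ℝ)..1, G (x, y) := by
  rw [← intervalIntegral.integral_sub ((continuous_integral_strip hF).intervalIntegrable _ _)
    ((continuous_integral_strip hG).intervalIntegrable _ _)]
  exact intervalIntegral.integral_congr fun x _ =>
    intervalIntegral.integral_sub (intervalIntegrable_slice hF x) (intervalIntegrable_slice hG x)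

theorem eq_zero_of_integral_strip_eq_zero {F : ℝ × ℝ → ℝ} (hF : ContinuousOn F strip)
    (h0 : ∀ p ∈ strip, 0 ≤ F p)
    (hi : ∫ x in (0 : ℝ)..(2 * Real.pi), ∫ y in (0 : ℝ)..1, F (x, y) = 0) {x y : ℝ}
    (hx : x ∈ Icc 0 (2 * Real.pi)) (hy : y ∈ Icc (0 : ℝ) 1) : F (x, y) = 0 := by
  have hinn : ∀ x, 0 ≤ ∫ y in (0 : ℝ)..1, F (x, y) := fun x =>
    intervalIntegral.integral_nonneg zero_le_one fun y hy => h0 _ ⟨mem_univ _, hy⟩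
  have hx0 : ∫ y in (0 : ℝ)..1, F (x, y) = 0 := by
    by_contra hne
    have := intervalIntegral.integral_pos Real.two_pi_pos
      (continuous_integral_strip hF).continuousOn (fun x _ => hinn x)
      ⟨x, hx, (hinn x).lt_of_ne' hne⟩
    linarith
  by_contra hne
  have hc : ContinuousOn (fun y => F (x, y)) (Icc 0 1) :=
    hF.comp (f := fun y => (x, y)) (by fun_prop) fun y hy => ⟨mem_univ _, hy⟩
  have := intervalIntegral.integral_pos zero_lt_one hc
    (fun y hy => h0 _ ⟨mem_univ _, Ioc_subset_Icc_self hy⟩)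
    ⟨y, hy, (h0 _ ⟨mem_univ _, hy⟩).lt_of_ne' hne⟩
  linarith

theorem exists_coe_Icc (x : Torus) : ∃ r ∈ Icc 0 (2 * Real.pi), (r : Torus) = x := by
  have : Fact (0 < 2 * Real.pi) := ⟨Real.two_pi_pos⟩
  obtain ⟨r, hr, hrx⟩ := AddCircle.eq_coe_Ico x
  exact ⟨r, ⟨hr.1, hr.2.le⟩, hrx⟩

/-- Energy uniqueness: the difference of two solutions is an admissible test function. -/
theorem IsStreamVariation.unique {ε : ℝ} {h : Torus × dom ε → ℝ} {f g : Channel → ℝ}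
    (hf : IsStreamVariation ε h f) (hg : IsStreamVariation ε h g) : f = g := by
  have hc := hf.isC1.sub hg.isC1
  have hw : VanishesOnWalls (f - g) := fun x y hy => by
    simp [hf.boundary x y hy, hg.boundary x y hy]
  have h1 := (hf.weak _ hc hw).trans (hg.weak _ hc hw).symm
  have hcont : ∀ {u : Channel → ℝ}, IsC1 (Icc 0 1) u →
      ContinuousOn (fun p => dx u p * dx (f - g) p + dy u p * dy (f - g) p) strip := fun hu =>
    (hu.continuousOn_dx.mul hc.continuousOn_dx).add (hu.continuousOn_dy.mul hc.continuousOn_dy)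
  have hdx : ∀ x, ∀ y ∈ Icc (0 : ℝ) 1, dx (f - g) (x, y) = dx f (x, y) - dx g (x, y) := by
    intro x y hy
    refine dx_eq hc hy ?_
    rw [lift_sub]
    exact (hf.isC1.hasDerivAt_dx x hy).sub (hg.isC1.hasDerivAt_dx x hy)
  have hdy : ∀ x, ∀ y ∈ Icc (0 : ℝ) 1, dy (f - g) (x, y) = dy f (x, y) - dy g (x, y) := by
    intro x y hy
    refine dy_eq hc hy ?_
    rw [lift_sub]
    exact (hf.isC1.hasDerivWithinAt_dy x hy).sub (hg.isC1.hasDerivWithinAt_dy x hy)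
  have h2 : ∫ x in (0 : ℝ)..(2 * Real.pi), ∫ y in (0 : ℝ)..1,
      (dx (f - g) (x, y) * dx (f - g) (x, y) + dy (f - g) (x, y) * dy (f - g) (x, y)) = 0 := by
    rw [← sub_eq_zero, ← integral_strip_sub (hcont hf.isC1) (hcont hg.isC1)] at h1
    refine Eq.trans ?_ h1
    refine intervalIntegral.integral_congr fun x _ => intervalIntegral.integral_congr fun y hy => ?_
    rw [uIcc_of_le zero_le_one] at hy
    rw [hdx x y hy, hdy x y hy]
    ring
  have h3 : ∀ x ∈ Icc 0 (2 * Real.pi), ∀ y ∈ Icc (0 : ℝ) 1, dy (f - g) (x, y) = 0 := by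
    intro x hx y hy
    have := eq_zero_of_integral_strip_eq_zero (hcont hc)
      (fun p _ => add_nonneg (mul_self_nonneg _) (mul_self_nonneg _)) h2 hx hy
    nlinarith [mul_self_nonneg (dx (f - g) (x, y)), mul_self_nonneg (dy (f - g) (x, y))]
  funext ⟨x, y, hy⟩
  obtain ⟨r, hr, rfl⟩ := exists_coe_Icc x
  have h0 : (0 : ℝ) ∈ Icc (0 : ℝ) 1 := by norm_num
  have hconst := (convex_Icc (0 : ℝ) 1).is_const_of_fderivWithin_eq_zero (𝕜 := ℝ)
      (f := fun y => lift (Icc 0 1) (f - g) (r, y))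
      (fun z hz => (hc.hasDerivWithinAt_dy r hz).differentiableWithinAt) (fun z hz => by
        have h4 := (hc.hasDerivWithinAt_dy r hz).hasFDerivWithinAt.fderivWithin
          (uniqueDiffOn_Icc zero_lt_one z hz)
        rw [h4, h3 r hr z hz]; ext; simp) hy h0
  rw [lift_apply _ r hy, lift_apply _ r h0, hw _ ⟨0, h0⟩ (Or.inl rfl)] at hconst
  simpa [sub_eq_zero] using hconst

/-- By uniqueness, the chosen stream function variation is any given one. -/
theorem IsStreamVariation.streamVariation_eq {ε : ℝ} {h : Torus × dom ε → ℝ} {f : Channel → ℝ}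
    (hf : IsStreamVariation ε h f) : streamVariation ε h = f := by
  have hex : ∃ f, IsStreamVariation ε h f := ⟨f, hf⟩
  unfold streamVariation
  rw [dif_pos hex]
  exact hex.choose_spec.unique hf

theorem IsGroundState.linearizedOp_eq_zero {ε lam : ℝ} {φ ψ : ℝ → ℝ}
    (h : IsGroundState ε lam φ ψ) :
    linearizedOp ε lam (separated (dom ε) 1 (kernelProfile ε lam φ)) = 0 := by
  funext ⟨x, y⟩
  have := h.ne y (dom_subset_closedDom ε y.2)
  simp only [linearizedOp, h.isStreamVariation.streamVariation_eq, separated, kernelProfile,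
    Pi.zero_apply]
  field_simp
  ring

/-! ### Regularity of the kernel element -/

theorem uniqueDiffOn_closedDom {ε : ℝ} (h1 : ε < 1) : UniqueDiffOn ℝ (closedDom ε) := by
  have ha : 0 < aEps ε := by unfold aEps; linarith
  have hb : bEps ε < 1 := by unfold bEps; linarith
  rintro y (hy | hy)
  · exact (uniqueDiffOn_Icc ha y hy).mono subset_union_left
  · exact (uniqueDiffOn_Icc hb y hy).mono subset_union_right

theorem contDiffOn_Psi0Deriv {ε : ℝ} (h0 : 0 < ε) (h1 : ε < 1) :
    ContDiffOn ℝ ∞ (Psi0Deriv ε) (closedDom ε) := by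
  refine contDiffOn_closedDom h0 ?_ ?_
  · exact ContDiffOn.congr (f := fun y => Psi0Deriv ε (aEps ε) + (aEps ε ^ 2 - y ^ 2))
      (by fun_prop) fun y hy => Psi0Deriv_left h0 h1 hy
  · exact ContDiffOn.congr (f := fun y => Psi0Deriv ε (bEps ε)
      - (2 * aEps ε * (y - bEps ε) + (y - bEps ε) ^ 2))
      (by fun_prop) fun y hy => Psi0Deriv_right h0 h1 hy

theorem IsGroundState.contDiffOn_kernelProfile {ε lam : ℝ} {φ ψ : ℝ → ℝ} (h0 : 0 < ε)
    (h1 : ε < 1) (h : IsGroundState ε lam φ ψ) :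
    ContDiffOn ℝ ∞ (kernelProfile ε lam φ) (closedDom ε) :=
  h.smooth.div (contDiffOn_const.sub (contDiffOn_Psi0Deriv h0 h1)) h.ne

theorem IsGroundState.smoothUpToBoundary {ε lam : ℝ} {φ ψ : ℝ → ℝ} (h0 : 0 < ε)
    (h1 : ε < 1) (h : IsGroundState ε lam φ ψ) :
    SmoothUpToBoundary ε (separated (dom ε) 1 (kernelProfile ε lam φ)) := by
  refine ⟨fun p => Real.cos ((1 : ℕ) * p.1) * kernelProfile ε lam φ p.2, ?_, fun x y => ?_⟩
  · have hc : ContDiff ℝ ∞ fun p : ℝ × ℝ => Real.cos ((1 : ℕ) * p.1) := by fun_prop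
    exact hc.contDiffOn.mul ((h.contDiffOn_kernelProfile h0 h1).comp contDiff_snd.contDiffOn
      fun p hp => hp.2)
  · simp only [separated, cosMode_coe]

/-- A smooth function on `[0, a] ∪ [b, 1]` is bounded and Lipschitz. Pairs of points in different
components are at distance at least `ε`, so there the bound alone suffices. -/
theorem exists_bound_lipschitz_closedDom {ε : ℝ} (h0 : 0 < ε) (h1 : ε < 1) {f : ℝ → ℝ}
    (hf : ContDiffOn ℝ ∞ f (closedDom ε)) :
    ∃ M L : ℝ, 0 ≤ M ∧ 0 ≤ L ∧ (∀ y ∈ closedDom ε, |f y| ≤ M) ∧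
      ∀ y ∈ closedDom ε, ∀ z ∈ closedDom ε, |f y - f z| ≤ L * |y - z| := by
  have ha : 0 < aEps ε := by unfold aEps; linarith
  have hb : bEps ε < 1 := by unfold bEps; linarith
  have hba : bEps ε - aEps ε = ε := by unfold aEps bEps; ring
  have hK : IsCompact (closedDom ε) := isCompact_Icc.union isCompact_Icc
  obtain ⟨M, hM⟩ := hK.exists_bound_of_continuousOn hf.continuousOn
  have hM' : ∀ y ∈ closedDom ε, |f y| ≤ max M 0 := fun y hy => (hM y hy).trans (le_max_left _ _)
  have hM0 : 0 ≤ max M 0 := le_max_right _ _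
  have piece : ∀ c d : ℝ, c < d → Icc c d ⊆ closedDom ε →
      ∃ L, ∀ y ∈ Icc c d, ∀ z ∈ Icc c d, |f y - f z| ≤ L * |y - z| := by
    intro c d hcd hsub
    have hfc := hf.mono hsub
    obtain ⟨L, hL⟩ := (isCompact_Icc (a := c) (b := d)).exists_bound_of_continuousOn
      (hfc.continuousOn_derivWithin (uniqueDiffOn_Icc hcd) (by simp))
    exact ⟨L, fun y hy z hz => (convex_Icc c d).norm_image_sub_le_of_norm_derivWithin_le
      (hfc.differentiableOn (by simp)) hL hz hy⟩
  obtain ⟨L₁, hL₁⟩ := piece 0 (aEps ε) ha subset_union_left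
  obtain ⟨L₂, hL₂⟩ := piece (bEps ε) 1 hb subset_union_right
  obtain ⟨N, hN⟩ : ∃ N, N = 2 * max M 0 / ε := ⟨_, rfl⟩
  have hN0 : 0 ≤ N := by rw [hN]; positivity
  have hcross : ∀ y ∈ closedDom ε, ∀ z ∈ closedDom ε, ε ≤ |y - z| → |f y - f z| ≤ N * |y - z| := by
    intro y hy z hz hyz
    calc |f y - f z| ≤ |f y| + |f z| := abs_sub _ _
      _ ≤ N * ε := by rw [hN]; field_simp; linarith [hM' y hy, hM' z hz]
      _ ≤ N * |y - z| := mul_le_mul_of_nonneg_left hyz hN0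
  have hmax : ∀ {C : ℝ} {y z : ℝ}, C ≤ max N (max L₁ L₂) → |f y - f z| ≤ C * |y - z| →
      |f y - f z| ≤ max N (max L₁ L₂) * |y - z| := fun hC h =>
    h.trans (mul_le_mul_of_nonneg_right hC (abs_nonneg _))
  refine ⟨max M 0, max N (max L₁ L₂), hM0, hN0.trans (le_max_left _ _), hM',
    fun y hy z hz => ?_⟩
  rcases hy with hy' | hy' <;> rcases hz with hz' | hz'
  · exact hmax ((le_max_left _ _).trans (le_max_right _ _)) (hL₁ y hy' z hz')
  · refine hmax (le_max_left _ _) (hcross y (Or.inl hy') z (Or.inr hz') ?_)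
    rw [abs_sub_comm]; exact le_trans (by linarith [hy'.2, hz'.1]) (le_abs_self _)
  · refine hmax (le_max_left _ _) (hcross y (Or.inr hy') z (Or.inl hz') ?_)
    exact le_trans (by linarith [hy'.1, hz'.2]) (le_abs_self _)
  · exact hmax ((le_max_right _ _).trans (le_max_right _ _)) (hL₂ y hy' z hz')

/-- A bounded Lipschitz function is Hölder continuous. -/
theorem le_mul_rpow_of_le {t d A B α : ℝ} (hd : 0 ≤ d) (hα0 : 0 ≤ α) (hα : α ≤ 1) (hA : 0 ≤ A)
    (hB : 0 ≤ B) (h1 : t ≤ A * d) (h2 : t ≤ B) : t ≤ (A + B) * d ^ α := by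
  rcases le_total d 1 with h | h
  · have h3 : d ≤ d ^ α := by
      simpa using Real.rpow_le_rpow_of_exponent_ge_of_imp hd h hα (by simp)
    nlinarith [mul_nonneg hB (hd.trans h3), mul_le_mul_of_nonneg_left h3 hA]
  · have h3 : 1 ≤ d ^ α := Real.one_le_rpow h hα0
    nlinarith [mul_le_mul_of_nonneg_left h3 hB, mul_nonneg hA (zero_le_one.trans h3)]

theorem abs_mul_sub_mul_le {s s' f f' M L u v : ℝ} (hs : |s| ≤ 1) (hf : |f'| ≤ M)
    (hss : |s - s'| ≤ u) (hff : |f - f'| ≤ L * v) :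
    |s * f - s' * f'| ≤ L * v + M * u := by
  have e : s * f - s' * f' = s * (f - f') + (s - s') * f' := by ring
  have hM : 0 ≤ M := (abs_nonneg _).trans hf
  have hu : 0 ≤ u := (abs_nonneg _).trans hss
  rw [e]
  refine (abs_add_le _ _).trans (add_le_add ?_ ?_)
  · rw [abs_mul]; exact (mul_le_of_le_one_left (abs_nonneg _) hs).trans hff
  · rw [abs_mul, mul_comm M u]; exact mul_le_mul hss hf (abs_nonneg _) hu

/-- `cos x g(y)` is of class `C^{1+α}` for smooth `g`: its derivative is bounded and Lipschitz. -/
theorem isC1Holder_separated {ε α : ℝ} (h0 : 0 < ε) (h1 : ε < 1) (hα0 : 0 ≤ α) (hα : α ≤ 1)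
    {g : ℝ → ℝ} (hg : ContDiffOn ℝ ∞ g (closedDom ε)) :
    IsC1Holder α (dom ε) (separated (dom ε) 1 g) := by
  have hu := uniqueDiffOn_closedDom h1
  have hg' : ContDiffOn ℝ ∞ (derivWithin g (closedDom ε)) (closedDom ε) :=
    hg.derivWithin hu (by simp)
  obtain ⟨g', hg'def⟩ : ∃ g', g' = derivWithin g (closedDom ε) := ⟨_, rfl⟩
  rw [← hg'def] at hg'
  obtain ⟨M, L, hM0, hL0, hM, hL⟩ := exists_bound_lipschitz_closedDom h0 h1 hg
  obtain ⟨M', L', hM'0, hL'0, hM', hL'⟩ := exists_bound_lipschitz_closedDom h0 h1 hg'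
  have hsub := dom_subset_closedDom ε
  refine ⟨fun p => Real.cos p.1 • (g' p.2 • ContinuousLinearMap.snd ℝ ℝ ℝ)
    + g p.2 • (-Real.sin p.1 • ContinuousLinearMap.fst ℝ ℝ ℝ), fun p hp => ?_,
    (L' + M') + (L + M) + (2 * M' + 2 * M), fun p hp q hq => ?_⟩
  · have hd1 : HasFDerivWithinAt (fun p : ℝ × ℝ => g p.2)
        (g' p.2 • ContinuousLinearMap.snd ℝ ℝ ℝ) (univ ×ˢ dom ε) p := by
      have hgd : HasDerivWithinAt g (g' p.2) (closedDom ε) p.2 := by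
        rw [hg'def]
        exact (hg.differentiableOn (by simp) p.2 (hsub hp.2)).hasDerivWithinAt
      exact hgd.comp_hasFDerivWithinAt p hasFDerivWithinAt_snd fun z hz => hsub hz.2
    have hd2 : HasFDerivWithinAt (fun p : ℝ × ℝ => Real.cos p.1)
        (-Real.sin p.1 • ContinuousLinearMap.fst ℝ ℝ ℝ) (univ ×ˢ dom ε) p :=
      (Real.hasDerivAt_cos p.1).comp_hasFDerivWithinAt p hasFDerivWithinAt_fst
    have heq : ∀ q ∈ univ ×ˢ dom ε, lift (dom ε) (separated (dom ε) 1 g) q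
        = Real.cos q.1 * g q.2 := fun q hq => by
      simpa using lift_separated (K := dom ε) 1 g q.1 hq.2
    exact (hd2.mul hd1).congr heq (heq p hp)
  · have hp2 := hsub hp.2
    have hq2 := hsub hq.2
    have dx1 : |p.1 - q.1| ≤ dist p q := by
      rw [Prod.dist_eq, ← Real.dist_eq]; exact le_max_left _ _
    have dy1 : |p.2 - q.2| ≤ dist p q := by
      rw [Prod.dist_eq, ← Real.dist_eq]; exact le_max_right _ _
    have hcos : |Real.cos p.1 - Real.cos q.1| ≤ dist p q := by
      refine le_trans ?_ dx1
      simpa [Real.dist_eq] using Real.lipschitzWith_cos.dist_le_mul p.1 q.1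
    have hsin : |Real.sin p.1 - Real.sin q.1| ≤ dist p q := by
      refine le_trans ?_ dx1
      simpa [Real.dist_eq] using Real.lipschitzWith_sin.dist_le_mul p.1 q.1
    have hnorm : ‖(Real.cos p.1 • (g' p.2 • ContinuousLinearMap.snd ℝ ℝ ℝ)
          + g p.2 • (-Real.sin p.1 • ContinuousLinearMap.fst ℝ ℝ ℝ))
        - (Real.cos q.1 • (g' q.2 • ContinuousLinearMap.snd ℝ ℝ ℝ)
          + g q.2 • (-Real.sin q.1 • ContinuousLinearMap.fst ℝ ℝ ℝ))‖
        ≤ |Real.cos p.1 * g' p.2 - Real.cos q.1 * g' q.2|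
          + |Real.sin p.1 * g p.2 - Real.sin q.1 * g q.2| := by
      have e : (Real.cos p.1 • (g' p.2 • ContinuousLinearMap.snd ℝ ℝ ℝ)
          + g p.2 • (-Real.sin p.1 • ContinuousLinearMap.fst ℝ ℝ ℝ))
        - (Real.cos q.1 • (g' q.2 • ContinuousLinearMap.snd ℝ ℝ ℝ)
          + g q.2 • (-Real.sin q.1 • ContinuousLinearMap.fst ℝ ℝ ℝ))
          = (Real.cos p.1 * g' p.2 - Real.cos q.1 * g' q.2) • ContinuousLinearMap.snd ℝ ℝ ℝ
            - (Real.sin p.1 * g p.2 - Real.sin q.1 * g q.2) • ContinuousLinearMap.fst ℝ ℝ ℝ := by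
        module
      rw [e]
      refine (norm_sub_le _ _).trans (add_le_add ?_ ?_)
      · rw [norm_smul, Real.norm_eq_abs]
        exact mul_le_of_le_one_right (abs_nonneg _) (ContinuousLinearMap.norm_snd_le _ _ _)
      · rw [norm_smul, Real.norm_eq_abs]
        exact mul_le_of_le_one_right (abs_nonneg _) (ContinuousLinearMap.norm_fst_le _ _ _)
    refine hnorm.trans (le_mul_rpow_of_le dist_nonneg hα0 hα (by positivity) (by positivity) ?_ ?_)
    · have k1 := abs_mul_sub_mul_le (Real.abs_cos_le_one p.1) (hM' _ hq2) hcos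
        ((hL' _ hp2 _ hq2).trans (mul_le_mul_of_nonneg_left dy1 hL'0))
      have k2 := abs_mul_sub_mul_le (Real.abs_sin_le_one p.1) (hM _ hq2) hsin
        ((hL _ hp2 _ hq2).trans (mul_le_mul_of_nonneg_left dy1 hL0))
      linarith
    · have hprod : ∀ s f N : ℝ, |s| ≤ 1 → |f| ≤ N → |s * f| ≤ N := fun s f N hs hf => by
        rw [abs_mul]; exact (mul_le_of_le_one_left (abs_nonneg _) hs).trans hf
      have k1 := abs_sub (Real.cos p.1 * g' p.2) (Real.cos q.1 * g' q.2)
      have k2 := abs_sub (Real.sin p.1 * g p.2) (Real.sin q.1 * g q.2)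
      have k3 := hprod _ _ _ (Real.abs_cos_le_one p.1) (hM' _ hp2)
      have k4 := hprod _ _ _ (Real.abs_cos_le_one q.1) (hM' _ hq2)
      have k5 := hprod _ _ _ (Real.abs_sin_le_one p.1) (hM _ hp2)
      have k6 := hprod _ _ _ (Real.abs_sin_le_one q.1) (hM _ hq2)
      linarith

theorem cosMode_neg (k : ℕ) (x : Torus) : cosMode k (-x) = cosMode k x := by
  obtain ⟨r, -, rfl⟩ := exists_coe_Icc x
  rw [← AddCircle.coe_neg, cosMode_coe, cosMode_coe, mul_neg, Real.cos_neg]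

theorem integral_cos_int_mul {m : ℤ} (hm : m ≠ 0) :
    ∫ x in (0 : ℝ)..(2 * Real.pi), Real.cos (m * x) = 0 := by
  have hm' : (m : ℝ) ≠ 0 := Int.cast_ne_zero.2 hm
  rw [intervalIntegral.integral_comp_mul_left (fun x => Real.cos x) hm', integral_cos]
  have : Real.sin (m * (2 * Real.pi)) = 0 := by
    simpa using Real.sin_add_int_mul_two_pi 0 m
  simp [this]

theorem IsGroundState.mem_holderSpace {ε lam α : ℝ} {φ ψ : ℝ → ℝ} (h0 : 0 < ε)
    (h1 : ε < 1) (hα0 : 0 ≤ α) (hα : α ≤ 1) (h : IsGroundState ε lam φ ψ) :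
    separated (dom ε) 1 (kernelProfile ε lam φ) ∈ holderSpace α ε := by
  refine ⟨isC1Holder_separated h0 h1 hα0 hα (h.contDiffOn_kernelProfile h0 h1), ?_, fun y => ?_,
    fun x y => ?_⟩
  · rintro x y (hy | hy) <;> simp [separated, kernelProfile, hy, h.zero, h.one]
  · have := integral_cos_int_mul (m := 1) one_ne_zero
    simp only [separated, cosMode_coe, intervalIntegral.integral_mul_const]
    push_cast at this ⊢
    rw [this, zero_mul]
  · simp only [separated, cosMode_neg]

/-! ### Fourier modes of kernel elements -/

theorem continuous_of_continuous_comp_coe {f : Torus → ℝ}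
    (hf : Continuous fun x : ℝ => f (x : Torus)) : Continuous f :=
  (QuotientAddGroup.isQuotientMap_mk (N := AddSubgroup.zmultiples (2 * Real.pi))).continuous_iff.2 hf

/-- An even continuous function on the torus with vanishing cosine coefficients is zero. -/
theorem eq_zero_of_cos_integral_eq_zero {f : Torus → ℝ}
    (hf : Continuous fun x : ℝ => f (x : Torus)) (heven : ∀ x, f (-x) = f x)
    (hcos : ∀ k : ℕ, ∫ x in (0 : ℝ)..(2 * Real.pi), Real.cos (k * x) * f (x : Torus) = 0) :
    f = 0 := by
  have : Fact (0 < 2 * Real.pi) := ⟨Real.two_pi_pos⟩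
  have hfc := continuous_of_continuous_comp_coe hf
  let F : C(Torus, ℂ) := ⟨fun x => (f x : ℂ), Complex.continuous_ofReal.comp hfc⟩
  have hcosZ : ∀ n : ℤ, ∫ x in (0 : ℝ)..(2 * Real.pi), Real.cos (n * x) * f (x : Torus) = 0 := by
    intro n
    refine Eq.trans ?_ (hcos n.natAbs)
    refine intervalIntegral.integral_congr fun x _ => ?_
    rcases Int.natAbs_eq n with h | h
    · conv_lhs => rw [h]
      simp
    · conv_lhs => rw [h]
      simp
  have hsin : ∀ n : ℤ, ∫ x in (0 : ℝ)..(2 * Real.pi), Real.sin (n * x) * f (x : Torus) = 0 := by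
    intro n
    have h1 := intervalIntegral.integral_comp_sub_left
      (fun x : ℝ => Real.sin (n * x) * f (x : Torus)) (a := 0) (b := 2 * Real.pi) (2 * Real.pi)
    have h2 : ∀ x : ℝ, Real.sin (n * (2 * Real.pi - x)) * f ((2 * Real.pi - x : ℝ) : Torus)
        = -(Real.sin (n * x) * f (x : Torus)) := by
      intro x
      have e1 : ((2 * Real.pi - x : ℝ) : Torus) = -(x : Torus) := by
        rw [AddCircle.coe_sub, AddCircle.coe_period, zero_sub]
      have e2 : Real.sin (n * (2 * Real.pi - x)) = -Real.sin (n * x) := by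
        rw [mul_sub]; exact Real.sin_int_mul_two_pi_sub _ _
      rw [e1, e2, heven]; ring
    simp_rw [h2] at h1
    rw [intervalIntegral.integral_neg, sub_self, sub_zero] at h1
    linarith
  have hcoef : ∀ n : ℤ, fourierCoeff F n = 0 := by
    intro n
    rw [fourierCoeff_eq_intervalIntegral F n 0]
    have h1 : ∀ x : ℝ, (fourier (-n) (x : Torus)) • F (x : Torus)
        = ((Real.cos (n * x) * f (x : Torus) : ℝ) : ℂ)
          - Complex.I * ((Real.sin (n * x) * f (x : Torus) : ℝ) : ℂ) := by
      intro x
      have e : 2 * (Real.pi : ℂ) * Complex.I * ((-n : ℤ) : ℂ) * x / ((2 * Real.pi : ℝ) : ℂ)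
          = ((-(n * x) : ℝ) : ℂ) * Complex.I := by
        have := Real.pi_ne_zero
        push_cast
        field_simp
      rw [fourier_coe_apply, e, Complex.exp_mul_I, ← Complex.ofReal_cos, ← Complex.ofReal_sin,
        Real.cos_neg, Real.sin_neg, smul_eq_mul]
      simp only [F, ContinuousMap.coe_mk]
      push_cast
      ring
    have hc1 : Continuous fun x : ℝ => ((Real.cos (n * x) * f (x : Torus) : ℝ) : ℂ) :=
      Complex.continuous_ofReal.comp (by fun_prop)
    have hc2 : Continuous fun x : ℝ =>
        Complex.I * ((Real.sin (n * x) * f (x : Torus) : ℝ) : ℂ) :=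
      continuous_const.mul (Complex.continuous_ofReal.comp (by fun_prop))
    simp_rw [h1]
    rw [zero_add, intervalIntegral.integral_sub (hc1.intervalIntegrable _ _)
      (hc2.intervalIntegrable _ _), intervalIntegral.integral_const_mul,
      intervalIntegral.integral_ofReal, intervalIntegral.integral_ofReal, hcosZ, hsin]
    simp
  have hsum := hasSum_fourier_series_of_summable (f := F)
    (by rw [show fourierCoeff F = 0 from funext hcoef]; exact summable_zero)
  have hF : F = 0 := by
    refine hsum.unique ?_
    simp_rw [hcoef, zero_smul]
    exact hasSum_zero
  funext x
  have := congrArg (fun G : C(Torus, ℂ) => G x) hF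
  simpa [F] using this

theorem integral_cos_mul_cos (k : ℕ) :
    ∫ x in (0 : ℝ)..(2 * Real.pi), Real.cos (k * x) * Real.cos x = if k = 1 then Real.pi else 0 := by
  have h : ∀ x : ℝ, Real.cos (k * x) * Real.cos x
      = 1 / 2 * Real.cos (((k - 1 : ℤ) : ℝ) * x) + 1 / 2 * Real.cos (((k + 1 : ℤ) : ℝ) * x) := by
    intro x
    push_cast
    rw [sub_mul, add_mul, one_mul, Real.cos_sub, Real.cos_add]; ring
  simp_rw [h]
  rw [intervalIntegral.integral_add (Continuous.intervalIntegrable (by fun_prop) _ _)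
    (Continuous.intervalIntegrable (by fun_prop) _ _), intervalIntegral.integral_const_mul,
    intervalIntegral.integral_const_mul, integral_cos_int_mul (m := k + 1) (by omega)]
  split_ifs with hk
  · subst hk; simp
  · rw [integral_cos_int_mul (m := k - 1) (by omega)]; simp

theorem IsStreamVariation.const_smul {ε : ℝ} {h : Torus × dom ε → ℝ} {f : Channel → ℝ}
    (hf : IsStreamVariation ε h f) (c : ℝ) : IsStreamVariation ε (c • h) (c • f) := by
  have hC : IsC1 (Icc 0 1) (c • f) := by
    unfold IsC1
    rw [lift_smul]
    exact contDiffOn_const.smul hf.isC1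
  refine ⟨hC, fun x y hy => by simp [hf.boundary x y hy], fun η hη hηw => ?_⟩
  have hdx : ∀ x, ∀ y ∈ Icc (0 : ℝ) 1, dx (c • f) (x, y) = c * dx f (x, y) := by
    intro x y hy
    refine dx_eq hC hy ?_
    rw [lift_smul]
    exact (hf.isC1.hasDerivAt_dx x hy).const_mul c
  have hdy : ∀ x, ∀ y ∈ Icc (0 : ℝ) 1, dy (c • f) (x, y) = c * dy f (x, y) := by
    intro x y hy
    refine dy_eq hC hy ?_
    rw [lift_smul]
    exact (hf.isC1.hasDerivWithinAt_dy x hy).const_mul c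
  have h1 := congrArg (c * ·) (hf.weak η hη hηw)
  simp only [mul_neg, ← intervalIntegral.integral_const_mul] at h1
  refine Eq.trans ?_ (h1.trans (congrArg Neg.neg ?_))
  · refine intervalIntegral.integral_congr fun x _ => intervalIntegral.integral_congr fun y hy => ?_
    rw [uIcc_of_le zero_le_one] at hy
    rw [hdx x y hy, hdy x y hy]
    ring
  · refine intervalIntegral.integral_congr fun x _ => intervalIntegral.integral_congr fun y _ => ?_
    simp only [vorticityVariation, lift_smul, Pi.smul_apply, smul_eq_mul]
    ring

/-- If `φ_h = (lam - Ψ₀') h`, the `k`-th mode of `φ_h` is a weak solution of `u'' = (k² + V) u`. -/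
theorem IsStreamVariation.mode_weak {ε lam : ℝ}
    (hne : ∀ y ∈ closedDom ε, lam - Psi0Deriv ε y ≠ 0)
    {h : Torus × dom ε → ℝ} {f : Channel → ℝ} (hf : IsStreamVariation ε h f)
    (hrel : ∀ (x : Torus) (y : dom ε), (lam - Psi0Deriv ε y) * h (x, y) = f (x, ⟨y, y.2.1⟩))
    (k : ℕ) {g g' : ℝ → ℝ} (hg : IsTestFunction g g') :
    ∫ y in (0 : ℝ)..1, ((k : ℝ) ^ 2 * (mode k f y * g y) + modeDeriv k f y * g' y)
      = -∫ y in (0 : ℝ)..1, rayleighPotential ε lam y * (mode k f y * g y) := by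
  obtain ⟨B, hB0, hB⟩ := exists_abs_rayleighPotential_le hne
  rw [← dirichlet_separated k hf.isC1 hg,
    ← weighted_separated k (measurable_rayleighPotential ε lam) hB hf.isC1 hg,
    hf.weak _ (isC1_separated k hg) (vanishesOnWalls_separated k hg)]
  congr 1
  refine intervalIntegral.integral_congr fun x _ => intervalIntegral.integral_congr fun y hy => ?_
  rw [uIcc_of_le zero_le_one] at hy
  rw [vorticityVariation_eq hne hrel x hy]
  ring

/-- The weak equation for the `k`-th mode, tested with the mode itself and written for the form of
`-d²/dy² + 1 + V`. -/
theorem IsStreamVariation.form_mode {ε lam : ℝ}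
    (hne : ∀ y ∈ closedDom ε, lam - Psi0Deriv ε y ≠ 0)
    {h : Torus × dom ε → ℝ} {f : Channel → ℝ} (hf : IsStreamVariation ε h f)
    (hrel : ∀ (x : Torus) (y : dom ε), (lam - Psi0Deriv ε y) * h (x, y) = f (x, ⟨y, y.2.1⟩))
    (k : ℕ) :
    (∫ y in (0 : ℝ)..1, modeDeriv k f y ^ 2)
        + (∫ y in (0 : ℝ)..1, (1 + rayleighPotential ε lam y) * mode k f y ^ 2)
      = (1 - (k : ℝ) ^ 2) * ∫ y in (0 : ℝ)..1, mode k f y ^ 2 := by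
  obtain ⟨B, hB0, hB⟩ := exists_abs_rayleighPotential_le hne
  have hm := isTestFunction_mode k hf.isC1 hf.boundary
  have hw := hf.mode_weak hne hrel k hm
  have hi1 : IntervalIntegrable (fun y => mode k f y ^ 2) volume 0 1 :=
    ContinuousOn.intervalIntegrable (by rw [uIcc_of_le zero_le_one]; exact hm.continuousOn.pow 2)
  have hi2 : IntervalIntegrable (fun y => modeDeriv k f y ^ 2) volume 0 1 :=
    ContinuousOn.intervalIntegrable (by rw [uIcc_of_le zero_le_one]; exact hm.cont.pow 2)
  have hi3 : IntervalIntegrable (fun y => rayleighPotential ε lam y * mode k f y ^ 2) volume 0 1 :=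
    intervalIntegrable_mul_of_bounded (measurable_rayleighPotential ε lam) hB
      (hm.continuousOn.pow 2)
  simp_rw [← pow_two] at hw
  rw [intervalIntegral.integral_add (hi1.const_mul _) hi2, intervalIntegral.integral_const_mul] at hw
  simp_rw [add_mul, one_mul]
  rw [intervalIntegral.integral_add hi1 hi3]
  linarith

/-- Modes `k ≥ 2` vanish, as `-k²` lies below the lowest eigenvalue. -/
theorem IsGroundState.mode_eq_zero {ε lam : ℝ} {φ ψ : ℝ → ℝ} (hφ : IsGroundState ε lam φ ψ)
    {h : Torus × dom ε → ℝ} {f : Channel → ℝ} (hf : IsStreamVariation ε h f)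
    (hrel : ∀ (x : Torus) (y : dom ε), (lam - Psi0Deriv ε y) * h (x, y) = f (x, ⟨y, y.2.1⟩))
    {k : ℕ} (hk : 2 ≤ k) {y : ℝ} (hy : y ∈ Icc (0 : ℝ) 1) : mode k f y = 0 := by
  have hm := isTestFunction_mode k hf.isC1 hf.boundary
  have h1 := hφ.form_nonneg hm
  rw [hf.form_mode hφ.ne hrel k] at h1
  have hk' : (2 : ℝ) ≤ k := by exact_mod_cast hk
  by_contra hne
  have hpos : 0 < ∫ y in (0 : ℝ)..1, mode k f y ^ 2 :=
    intervalIntegral.integral_pos zero_lt_one (hm.continuousOn.pow 2)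
      (fun y _ => sq_nonneg _) ⟨y, hy, by positivity⟩
  have hk2 : (1 : ℝ) - k ^ 2 < 0 := by nlinarith
  have := mul_neg_of_neg_of_pos hk2 hpos
  linarith

theorem IsGroundState.exists_mode_one_eq {ε lam : ℝ} {φ ψ : ℝ → ℝ}
    (hφ : IsGroundState ε lam φ ψ)
    {h : Torus × dom ε → ℝ} {f : Channel → ℝ} (hf : IsStreamVariation ε h f)
    (hrel : ∀ (x : Torus) (y : dom ε), (lam - Psi0Deriv ε y) * h (x, y) = f (x, ⟨y, y.2.1⟩)) :
    ∃ c, ∀ y ∈ Icc (0 : ℝ) 1, mode 1 f y = c * φ y :=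
  hφ.eq_smul_of_form_eq_zero (isTestFunction_mode 1 hf.isC1 hf.boundary)
    (by rw [hf.form_mode hφ.ne hrel 1]; simp)

/-- Every kernel element is a multiple of `cos x φ(y) / (lam - Ψ₀'(y))`. -/
theorem IsGroundState.exists_eq_smul_of_mem_kernel {ε lam α : ℝ} {φ ψ : ℝ → ℝ}
    (hφ : IsGroundState ε lam φ ψ) {h : Torus × dom ε → ℝ} (hh : h ∈ kernel α ε lam) :
    ∃ c : ℝ, c • separated (dom ε) 1 (kernelProfile ε lam φ) = h := by
  obtain ⟨⟨hC, -, hmean, heven⟩, hL⟩ := hh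
  have hne : ∀ y : dom ε, lam - Psi0Deriv ε y ≠ 0 := fun y =>
    hφ.ne y (dom_subset_closedDom ε y.2)
  have hrel : ∀ (x : Torus) (y : dom ε), (lam - Psi0Deriv ε y) * h (x, y)
      = streamVariation ε h (x, ⟨y, y.2.1⟩) := fun x y => by
    have := congrFun hL (x, y)
    simp only [linearizedOp, Pi.zero_apply] at this
    linarith
  by_cases hex : ∃ f, IsStreamVariation ε h f
  · obtain ⟨f, hf⟩ := hex
    rw [hf.streamVariation_eq] at hrel
    obtain ⟨c, hc⟩ := hφ.exists_mode_one_eq hf hrel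
    refine ⟨c / Real.pi, ?_⟩
    have hmode : ∀ (k : ℕ) (y : dom ε),
        ∫ x in (0 : ℝ)..(2 * Real.pi), Real.cos (k * x) * h ((x : Torus), y)
          = mode k f y / (lam - Psi0Deriv ε y) := by
      intro k y
      rw [eq_div_iff (hne y), mode, ← intervalIntegral.integral_mul_const]
      refine intervalIntegral.integral_congr fun x _ => ?_
      have := hrel (x : Torus) y
      rw [lift_apply f x y.2.1, ← this]
      ring
    suffices ∀ y : dom ε, (fun x : Torus => h (x, y)
        - c / Real.pi * separated (dom ε) 1 (kernelProfile ε lam φ) (x, y)) = 0 by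
      funext ⟨x, y⟩
      have := congrFun (this y) x
      simp only [Pi.zero_apply] at this
      simp only [Pi.smul_apply, smul_eq_mul]
      linarith
    intro y
    have hcont : Continuous fun x : ℝ => h ((x : Torus), y) := hC.continuous_slice y
    have hsep : ∀ x : ℝ, separated (dom ε) 1 (kernelProfile ε lam φ) ((x : Torus), y)
        = Real.cos x * kernelProfile ε lam φ y := fun x => by
      simp [separated, cosMode_coe]
    refine eq_zero_of_cos_integral_eq_zero ?_ (fun x => ?_) (fun k => ?_)
    · simp_rw [hsep]; exact hcont.sub (by fun_prop)
    · simp only [separated, cosMode_neg, heven]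
    · have e : ∀ x : ℝ, Real.cos (k * x) * (h ((x : Torus), y)
          - c / Real.pi * separated (dom ε) 1 (kernelProfile ε lam φ) ((x : Torus), y))
          = Real.cos (k * x) * h ((x : Torus), y)
            - c / Real.pi * kernelProfile ε lam φ y * (Real.cos (k * x) * Real.cos x) := by
        intro x; rw [hsep]; ring
      simp_rw [e]
      have hcos : Continuous fun x : ℝ => Real.cos (k * x) * h ((x : Torus), y) :=
        Continuous.mul (by fun_prop) hcont
      rw [intervalIntegral.integral_sub (hcos.intervalIntegrable _ _)
        (Continuous.intervalIntegrable (by fun_prop) _ _), intervalIntegral.integral_const_mul,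
        integral_cos_mul_cos]
      rcases Nat.lt_or_ge k 2 with hk | hk
      -- `k = 0` is the zero mean of `h`; `k = 1` fixes the constant since `∫ cos² = π`
      · interval_cases k
        · simpa using hmean y
        · rw [hmode, hc y y.2.1, if_pos rfl, kernelProfile]
          have := Real.pi_ne_zero
          field_simp
          ring
      · rw [hmode, hφ.mode_eq_zero hf hrel hk y.2.1, if_neg (by omega)]
        simp
  · refine ⟨0, ?_⟩
    -- without a solution of the Dirichlet problem `streamVariation` is `0` by convention, and so is `h`
    have h0 : streamVariation ε h = 0 := by unfold streamVariation; rw [dif_neg hex]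
    funext ⟨x, y⟩
    have := hrel x y
    rw [h0] at this
    simp only [Pi.zero_apply, mul_eq_zero, hne y, false_or] at this
    simp [this]

theorem IsGroundState.kernel_eq {ε lam α : ℝ} {φ ψ : ℝ → ℝ} (h0 : 0 < ε)
    (h1 : ε < 1) (hα0 : 0 ≤ α) (hα : α ≤ 1) (hφ : IsGroundState ε lam φ ψ) :
    kernel α ε lam = (Submodule.span ℝ {separated (dom ε) 1 (kernelProfile ε lam φ)} :
      Set (Torus × dom ε → ℝ)) := by
  have hmem := hφ.mem_holderSpace h0 h1 hα0 hα
  ext h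
  rw [SetLike.mem_coe, Submodule.mem_span_singleton]
  refine ⟨hφ.exists_eq_smul_of_mem_kernel, ?_⟩
  rintro ⟨c, rfl⟩
  refine ⟨Submodule.smul_mem _ c hmem, ?_⟩
  have h2 := hφ.linearizedOp_eq_zero
  have h3 := hφ.isStreamVariation
  funext p
  have h4 := congrFun h2 p
  simp only [linearizedOp, h3.streamVariation_eq, (h3.const_smul c).streamVariation_eq,
    Pi.smul_apply, smul_eq_mul, Pi.zero_apply] at h4 ⊢
  linear_combination c * h4

theorem IsGroundState.kernelElement_ne_zero {ε lam : ℝ} {φ ψ : ℝ → ℝ} (h0 : 0 < ε)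
    (h1 : ε < 1) (hφ : IsGroundState ε lam φ ψ) :
    separated (dom ε) 1 (kernelProfile ε lam φ) ≠ 0 := by
  have ha : 0 < aEps ε := by unfold aEps; linarith
  have hy : aEps ε / 2 ∈ dom ε :=
    ⟨⟨by linarith, by unfold aEps; linarith⟩, Or.inl (by linarith)⟩
  intro h
  have h2 := congrFun h (((0 : ℝ) : Torus), ⟨aEps ε / 2, hy⟩)
  have h3 := hφ.pos (aEps ε / 2) ⟨by linarith, by unfold aEps; linarith⟩
  have h4 := hφ.ne _ (dom_subset_closedDom ε hy)
  simp only [separated, cosMode_coe, kernelProfile, mul_zero, Real.cos_zero, one_mul,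
    Pi.zero_apply, div_eq_zero_iff, h3.ne', h4, or_self] at h2

end Poiseuille

theorem theorem6p1 :
    ∃ ε₀ : ℝ, 0 < ε₀ ∧ ∀ ε : ℝ, 0 < ε → ε < ε₀ →
      ∃ lam : ℝ,
        (∀ y ∈ Poiseuille.closedDom ε, lam - Poiseuille.Psi0Deriv ε y ≠ 0) ∧
        ∃ h : Poiseuille.Torus × Poiseuille.dom ε → ℝ,
          h ≠ 0 ∧ Poiseuille.SmoothUpToBoundary ε h ∧
          ∀ α : ℝ, 1 / 2 ≤ α → α < 1 →
            Poiseuille.kernel α ε lam =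
              (Submodule.span ℝ {h} : Set (Poiseuille.Torus × Poiseuille.dom ε → ℝ)) := by
  refine ⟨1, one_pos, fun ε h0 h1 => ?_⟩
  obtain ⟨lam, φ, ψ, hφ⟩ := Poiseuille.exists_groundState h0 h1
  exact ⟨lam, hφ.ne, _, hφ.kernelElement_ne_zero h0 h1, hφ.smoothUpToBoundary h0 h1,
    fun α hα0 hα => hφ.kernel_eq h0 h1 (by linarith) hα.le⟩
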